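/- Let $F=\mathbb R$ or $\mathbb C$ and $n\ge 4$. A (left) Leibniz algebra over $F$ is a vector space with a bilinear bracket satisfying $[x,[y,z]]=[[x,y],z]+[y,[x,z]]$; it is Lie if moreover $[x,y]=-[y,x]$. Let $T(n)$ be the Lie algebra with basis $N_{ik}$ ($1\le i<k\le n$) and brackets $[N_{ik},N_{ab}]=\delta_{ka}N_{ib}-\delta_{bi}N_{ak}$. Matrices $A^1,\dots,A^f$ are called nilindependent if no nonzero linear combination of them is nilpotent. **Theorem.** Let $L$ be a finite-dimensional, non-nilpotent, solvable Leibniz algebra over $F$ whose nilradical (greatest nilpotent ideal) is isomorphic to $T(n)$. Then $\dim L=\tfrac12 n(n-1)+f$ for some $f$ with $1\le f\le n-1$, and $L$ has a basis $\{X^\alpha,N_{ik}\}$ ($1\le\alpha\le f$, $1\le i<k\le n$), in which the $N_{ik}$ form a basis of the nilradical, such that $$[N_{ik},N_{ab}]=\delta_{ka}N_{ib}-\delta_{bi}N_{ak},\quad [X^\alpha,N_{ik}]=\sum_{p<q}A^\alpha_{ik,pq}N_{pq},\quad [N_{ik},X^\alpha]=\sum_{p<q}B^\alpha_{ik,pq}N_{pq},\quad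 [X^\alpha,X^\beta]=\sigma^{\alpha\beta}N_{1n}$$ with $A^\alpha_{ik,pq},B^\alpha_{ik,pq},\sigma^{\alpha\beta}\in F$, and the following hold. 1. The $A^\alpha$ are nilindependent, and $[A^\alpha,A^\beta]=[A^\alpha,B^\beta]=0$ for all $\alpha,\beta$. With the index pairs ordered as $12,23,\dots,(n-1)n,13,\dots,(n-2)n,\dots,1n$, all $A^\alpha$ and $B^\alpha$ are upper triangular. Their diagonal entries satisfy $C_{ik,ik}=\sum_{j=i}^{k-1}C_{j(j+1),j(j+1)}$ for $C=A^\alpha$ and $C=B^\alpha$. The off-diagonal entries of $A^\alpha$ vanish except possibly at the positions $(12,2n)$, $(j(j+1),1n)$ with $2\le j\le n-2$, and $((n-1)n,1(n-1))$; those of $B^\alpha$ vanish except possibly at the positions $(12,2n)$, $(j(j+1),1n)$ with $1\le j\le n-1$, and $((n-1)n,1(n-1))$. 2. $B^\alpha_{ik,ab}=-A^\alpha_{ik,ab}$ for $ab\ne 1n$, and $B^\alpha_{1n,1n}=-A^\alpha_{1n,1n}$. 3. If $A^\gamma_{1n,1n}\neq0$ for some $\gamma$, then $L$ is a Lie algebra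 and all $\sigma^{\alpha\beta}=0$. 4. For $ik\ne ab$, the entries $A^\alpha_{ik,ab}$ and $B^\alpha_{ik,ab}$ vanish (for all $\alpha$) unless $A^\beta_{ik,ik}=A^\beta_{ab,ab}$ for all $\beta=1,\dots,f$. 5. If $f=n-1$, then $L$ is Lie, all $A^\alpha$ are diagonal and all $\sigma^{\alpha\beta}=0$. The diagonal entries $A^\alpha_{j(j+1),j(j+1)}$ are free: for every $f\ge1$ and all linearly independent vectors $d^1,\dots,d^f\in F^{n-1}$, some such algebra has a basis as above with $A^\alpha_{j(j+1),j(j+1)}=d^\alpha_j$ for $1\le j\le n-1$. Finally, for $f=n-1$ there is, up to isomorphism, exactly one such algebra; it is a Lie algebra having a basis as above in which all $A^\alpha$ are diagonal and the $X^\alpha$ commute. -/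

import Mathlib

universe u v

namespace Leibniz

section General

variable {F : Type*} [Field F] {L : Type*} [AddCommGroup L] [Module F L]
variable {M : Type*} [AddCommGroup M] [Module F M]

/-- A bilinear bracket `[x, y] = br x y` is a (left) Leibniz bracket if
`[x,[y,z]] = [[x,y],z] + [y,[x,z]]`. -/
def IsLeibniz (br : L →ₗ[F] L →ₗ[F] L) : Prop :=
  ∀ x y z : L, br x (br y z) = br (br x y) z + br y (br x z)

/-- A Lie algebra is a Leibniz algebra whose bracket is antisymmetric (used in characteristic 0). -/
def IsLie (br : L →ₗ[F] L →ₗ[F] L) : Prop :=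
  IsLeibniz br ∧ ∀ x y : L, br x y = -br y x

/-- Two-sided ideals. -/
def IsIdeal (br : L →ₗ[F] L →ₗ[F] L) (I : Submodule F L) : Prop :=
  ∀ x : L, ∀ y ∈ I, br x y ∈ I ∧ br y x ∈ I

/-- The derived series; `Submodule.map₂ br I J` is the span of all `[x, y]`, `x ∈ I`, `y ∈ J`. -/
def derivedSeries (br : L →ₗ[F] L →ₗ[F] L) : ℕ → Submodule F L
  | 0 => ⊤
  | k + 1 => Submodule.map₂ br (derivedSeries br k) (derivedSeries br k)

def IsSolvable (br : L →ₗ[F] L →ₗ[F] L) : Prop :=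
  ∃ k, derivedSeries br k = ⊥

/-- The lower central series `I, [I, I], [I, [I, I]], …` of a subspace `I` (in practice of an ideal,
or of the whole algebra `⊤`), with the bracket taken inside `I`. -/
def lowerCentralSeries (br : L →ₗ[F] L →ₗ[F] L) (I : Submodule F L) : ℕ → Submodule F L
  | 0 => I
  | k + 1 => Submodule.map₂ br I (lowerCentralSeries br I k)

def IsNilpotentSubalgebra (br : L →ₗ[F] L →ₗ[F] L) (I : Submodule F L) : Prop :=
  ∃ k, lowerCentralSeries br I k = ⊥

/-- `R` is the nilradical: the greatest nilpotent two-sided ideal. -/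
def IsNilradical (br : L →ₗ[F] L →ₗ[F] L) (R : Submodule F L) : Prop :=
  IsGreatest {I : Submodule F L | IsIdeal br I ∧ IsNilpotentSubalgebra br I} R

/-- Isomorphism of Leibniz algebras. -/
def IsIsomorphic (br : L →ₗ[F] L →ₗ[F] L) (br' : M →ₗ[F] M →ₗ[F] M) : Prop :=
  ∃ e : L ≃ₗ[F] M, ∀ x y : L, e (br x y) = br' (e x) (e y)

end General

/-- The pairs `(i, k)` with `1 ≤ i < k ≤ n`. -/
def pairs (n : ℕ) : Finset (ℕ × ℕ) :=
  (Finset.Icc 1 n ×ˢ Finset.Icc 1 n).filter fun p => p.1 < p.2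

theorem mem_pairs {n : ℕ} {p : ℕ × ℕ} : p ∈ pairs n ↔ 1 ≤ p.1 ∧ p.1 < p.2 ∧ p.2 ≤ n := by
  simp only [pairs, Finset.mem_filter, Finset.mem_product, Finset.mem_Icc]
  omega

/-- The index set of the basis `N_{ik}`, `1 ≤ i < k ≤ n`, of `T(n)`. -/
abbrev Idx (n : ℕ) : Type := ↥(pairs n)

/-- The index `1n`. -/
def Idx.corner {n : ℕ} (hn : 4 ≤ n) : Idx n :=
  ⟨(1, n), mem_pairs.2 ⟨le_rfl, by show 1 < n; omega, le_rfl⟩⟩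

/-- If `p = (i,k)` and `q = (k,b)`, this is the index `(i,b)`. -/
def Idx.join {n : ℕ} (p q : Idx n) (h : p.1.2 = q.1.1) : Idx n :=
  ⟨(p.1.1, q.1.2), mem_pairs.2
    ⟨(mem_pairs.1 p.2).1,
      lt_trans (mem_pairs.1 p.2).2.1 (lt_of_eq_of_lt h (mem_pairs.1 q.2).2.1),
      (mem_pairs.1 q.2).2.2⟩⟩

/-- The order of the basis of `T(n)` along consecutive off-diagonals:
`N_{12}, N_{23}, …, N_{(n-1)n}, N_{13}, …, N_{(n-2)n}, …, N_{1n}`. -/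
def Idx.position {n : ℕ} (p : Idx n) : ℕ ×ₗ ℕ :=
  toLex (p.1.2 - p.1.1, p.1.1)

section Triangular

variable {F : Type*} [Field F] {L : Type*} [AddCommGroup L] [Module F L]

/-- The relations `[N_{ik}, N_{ab}] = δ_{ka} N_{ib} - δ_{bi} N_{ak}` of `T(n)`. -/
def TriangularRelations {n : ℕ} (br : L →ₗ[F] L →ₗ[F] L) (N : Idx n → L) : Prop :=
  ∀ p q : Idx n, br (N p) (N q) =
    (if h : p.1.2 = q.1.1 then N (p.join q h) else 0) -
      (if h : q.1.2 = p.1.1 then N (q.join p h) else 0)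

/-- The nilradical is (isomorphic to) `T(n)`: it has a basis `N_{ik}` with the relations
of `T(n)`. -/
def HasTriangularNilradical (n : ℕ) (br : L →ₗ[F] L →ₗ[F] L) : Prop :=
  ∃ N : Idx n → L, LinearIndependent F N ∧
    IsNilradical br (Submodule.span F (Set.range N)) ∧ TriangularRelations br N

/-- `br` makes `L` a non-nilpotent solvable Leibniz algebra with nilradical `T(n)`. Non-nilpotent
means that the nilradical is not all of `L`. -/
structure IsTriangularExtension (n : ℕ) (br : L →ₗ[F] L →ₗ[F] L) : Prop where
  leibniz : IsLeibniz br
  solvable : IsSolvable br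
  nilradical : HasTriangularNilradical n br
  not_nilpotent : ¬ IsNilpotentSubalgebra br ⊤

/-- No nonzero linear combination of the matrices is nilpotent. -/
def Nilindependent {n f : ℕ} (A : Fin f → Matrix (Idx n) (Idx n) F) : Prop :=
  ∀ c : Fin f → F, IsNilpotent (∑ α, c α • A α) → c = 0

/-- The off-diagonal positions `(12,2n)`, `(j(j+1),1n)` for `2 ≤ j ≤ n-2`,
and `((n-1)n,1(n-1))`. -/
def OffDiagA {n : ℕ} (p q : Idx n) : Prop :=
  (p.1 = (1, 2) ∧ q.1 = (2, n)) ∨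
  (∃ j, 2 ≤ j ∧ j ≤ n - 2 ∧ p.1 = (j, j + 1) ∧ q.1 = (1, n)) ∨
  (p.1 = (n - 1, n) ∧ q.1 = (1, n - 1))

/-- The off-diagonal positions `(12,2n)`, `(j(j+1),1n)` for `1 ≤ j ≤ n-1`,
and `((n-1)n,1(n-1))`. -/
def OffDiagB {n : ℕ} (p q : Idx n) : Prop :=
  (p.1 = (1, 2) ∧ q.1 = (2, n)) ∨
  (∃ j, 1 ≤ j ∧ j ≤ n - 1 ∧ p.1 = (j, j + 1) ∧ q.1 = (1, n)) ∨
  (p.1 = (n - 1, n) ∧ q.1 = (1, n - 1))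

/-- `C` is upper triangular, its nonzero off-diagonal entries are at the positions in `P`, and
`C_{ik,ik} = ∑_{j=i}^{k-1} C_{j(j+1),j(j+1)}`. -/
structure HasForm {n : ℕ} (P : Idx n → Idx n → Prop) (C : Matrix (Idx n) (Idx n) F) : Prop where
  upper : C.BlockTriangular Idx.position
  offDiag : ∀ p q, p ≠ q → ¬ P p q → C p q = 0
  diag : ∀ p : Idx n, C p p =
    ∑ r with r.1.2 = r.1.1 + 1 ∧ p.1.1 ≤ r.1.1 ∧ r.1.2 ≤ p.1.2, C r r

/-- The basis `b`, consisting of `X^α = b (inl α)` and `N_{ik} = b (inr ik)`, the matrices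
`A^α, B^α` and the constants `σ^{αβ}` are a canonical presentation of the Leibniz algebra. -/
structure IsCanonical {n f : ℕ} (hn : 4 ≤ n) (br : L →ₗ[F] L →ₗ[F] L)
    (b : Module.Basis (Fin f ⊕ Idx n) F L)
    (A B : Fin f → Matrix (Idx n) (Idx n) F) (σ : Fin f → Fin f → F) : Prop where
  nilradical : IsNilradical br (Submodule.span F (Set.range fun p : Idx n => b (.inr p)))
  bracket_N_N : TriangularRelations br fun p : Idx n => b (.inr p)
  bracket_X_N : ∀ α p, br (b (.inl α)) (b (.inr p)) = ∑ q, A α p q • b (.inr q)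
  bracket_N_X : ∀ α p, br (b (.inr p)) (b (.inl α)) = ∑ q, B α p q • b (.inr q)
  bracket_X_X : ∀ α β, br (b (.inl α)) (b (.inl β)) = σ α β • b (.inr (Idx.corner hn))
  nilindependent : Nilindependent A
  form_A : ∀ α, HasForm OffDiagA (A α)
  form_B : ∀ α, HasForm OffDiagB (B α)
  commute_A_A : ∀ α β, Commute (A α) (A β)
  commute_A_B : ∀ α β, Commute (A α) (B β)
  B_eq_neg_A : ∀ α p q, q ≠ Idx.corner hn → B α p q = -A α p q
  B_corner : ∀ α, B α (Idx.corner hn) (Idx.corner hn) = -A α (Idx.corner hn) (Idx.corner hn)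
  lie_of_corner : (∃ γ, A γ (Idx.corner hn) (Idx.corner hn) ≠ 0) →
    IsLie br ∧ ∀ α β, σ α β = 0
  offDiag_zero : ∀ α p q, p ≠ q → (∃ β, A β p p ≠ A β q q) → A α p q = 0 ∧ B α p q = 0
  maximal : f = n - 1 → IsLie br ∧ (∀ α, (A α).IsDiag) ∧ ∀ α β, σ α β = 0

end Triangular

end Leibniz

/-!
Let `D` be the left multiplication by an element of `L`, restricted to `T(n)`; it is a derivation.
Writing that `D` respects the defining relations of `T(n)` between the generators `N_{j(j+1)}`, one
finds that `D N_{j(j+1)}` has coefficients only in row `j` and column `j + 1` and, since `n ≥ 4`, at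
one exceptional position: `2n` for `j = 1`, `1(n-1)` for `j = n - 1`, and `1n` otherwise
(`IsDerivationCoeff.eq_zero`). The coefficients in row `j` and column `j + 1` fit together to those
of an inner derivation (`IsDerivationCoeff.coherent`). Hence every element of `L` may be changed by
an element of `T(n)` so as to act diagonally up to the exceptional terms (`IsFrame.exists_normal`).

The diagonal entries at the generators are linear functionals on `L`, the weights. They vanish on
`[L, L]` and on `T(n)`, and elements with vanishing weights act strictly triangularly. With
solvability this forces the common kernel of the weights to be the nilradical
(`IsFrame.weightKer_le`), so that `f ≤ n - 1` and the `A^α` are nilindependent.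

An element of `T(n)` which commutes with all generators up to exceptional terms is a multiple of
`N_{1n}` (`IsFrame.eq_smul_corner`). This applies to `[X^α, X^β]`, and to the symmetrized products
`[N, X] + [X, N]`, which are left annihilators in any Leibniz algebra; it gives `σ` and the relation
between `A` and `B`. If some `X^γ` does not commute with `N_{1n}`, then no nonzero multiple of
`N_{1n}` is a left annihilator, so `L` is a Lie algebra, and adding multiples of `N_{1n}` to the
`X^α` makes them commute (`IsNormal.exists_commuting`). Exceptional terms between different weights
are removed by a unipotent change of the generators of `T(n)` (`IsNormal.exists_reduced`).

Conversely, diagonal matrices with independent weights span together with `T(n)` a Lie algebra of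
upper triangular matrices, which realizes the given weights (`exists_model_isNormal`). If
`f = n - 1`, all weights occur, nothing but the diagonal entries is left in the normal form, and
linear combinations of the `X^α` have any prescribed independent weights, which gives uniqueness
(`IsNormal.isIsomorphic`).
-/

namespace Leibniz

/-! ### Index pairs -/

section Index

variable {n : ℕ}

/-- The pair `(i, i + 1)`: the index of a generator of `T(n)`. -/
def Idx.Simple (p : Idx n) : Prop := p.1.2 = p.1.1 + 1

instance (p : Idx n) : Decidable p.Simple := inferInstanceAs (Decidable (_ = _))

/-- The only pair `ab`, apart from those with `a = j` or `b = j + 1`, such that a derivation of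
`T(n)` may map `N_{j(j+1)}` to an element with a nonzero coefficient at `N_{ab}`. -/
def exceptional (n j : ℕ) : ℕ × ℕ :=
  if j = 1 then (2, n) else if j + 1 = n then (1, n - 1) else (1, n)

theorem exceptional_mem (hn : 4 ≤ n) (j : ℕ) : exceptional n j ∈ pairs n := by
  rw [mem_pairs, exceptional]
  split_ifs <;> simp only <;> omega

/-- The pair `exceptional n i`, as an index, for an index `(i, k)`. -/
def Idx.target (hn : 4 ≤ n) (p : Idx n) : Idx n :=
  ⟨exceptional n p.1.1, exceptional_mem hn _⟩

theorem Idx.one_le (p : Idx n) : 1 ≤ p.1.1 := (mem_pairs.1 p.2).1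
theorem Idx.lt (p : Idx n) : p.1.1 < p.1.2 := (mem_pairs.1 p.2).2.1
theorem Idx.le (p : Idx n) : p.1.2 ≤ n := (mem_pairs.1 p.2).2.2

theorem mk_mem_pairs {i k : ℕ} : (i, k) ∈ pairs n ↔ 1 ≤ i ∧ i < k ∧ k ≤ n := mem_pairs

theorem Idx.ext' {p q : Idx n} (h1 : p.1.1 = q.1.1) (h2 : p.1.2 = q.1.2) : p = q :=
  Subtype.ext (Prod.ext h1 h2)

theorem Idx.not_simple_target (hn : 4 ≤ n) (p : Idx n) : ¬ (p.target hn).Simple := by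
  simp only [Idx.target, Idx.Simple, exceptional]
  split_ifs <;> simp only <;> omega

theorem Idx.not_simple_corner (hn : 4 ≤ n) : ¬ (Idx.corner hn).Simple := by
  simp only [Idx.corner, Idx.Simple]
  omega

theorem Idx.target_ne (hn : 4 ≤ n) {p : Idx n} (hp : p.Simple) : p.target hn ≠ p :=
  fun h => Idx.not_simple_target hn p (h.symm ▸ hp)

theorem card_idx (n : ℕ) : Fintype.card (Idx n) = n * (n - 1) / 2 := by
  rw [Fintype.card_coe, ← Finset.sum_range_id,
    ← Finset.sum_congr rfl (fun k _ => Finset.card_range k), ← Finset.card_sigma]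
  refine Finset.card_bij' (fun p _ => ⟨p.2 - 1, p.1 - 1⟩) (fun s _ => (s.2 + 1, s.1 + 1))
    ?_ ?_ ?_ ?_
  · rintro ⟨i, k⟩ h
    rw [mk_mem_pairs] at h
    simp only [Finset.mem_sigma, Finset.mem_range]
    omega
  · rintro ⟨k, i⟩ h
    simp only [Finset.mem_sigma, Finset.mem_range] at h
    rw [mk_mem_pairs]
    refine ⟨by omega, ?_, ?_⟩ <;> simp only <;> omega
  · rintro ⟨i, k⟩ h
    rw [mk_mem_pairs] at h
    ext <;> simp only <;> omega
  · rintro ⟨k, i⟩ h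
    simp

/-- A sum over the generators `N_{j(j+1)}` with `i ≤ j < k` telescopes. -/
theorem sum_simple_telescope {F : Type*} [Field F] (h : ℕ → F) (p : Idx n) :
    ∑ r : Idx n with r.1.2 = r.1.1 + 1 ∧ p.1.1 ≤ r.1.1 ∧ r.1.2 ≤ p.1.2, (h r.1.1 - h r.1.2) =
      h p.1.1 - h p.1.2 := by
  rw [← neg_sub (h p.1.2), ← Finset.sum_Ico_sub h p.lt.le, ← Finset.sum_neg_distrib]
  refine Finset.sum_bij (fun r _ => r.1.1) ?_ ?_ ?_ ?_
  · intro r hr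
    simp only [Finset.mem_filter, Finset.mem_univ, true_and] at hr
    rw [Finset.mem_Ico]
    omega
  · intro r hr s hs hrs
    simp only [Finset.mem_filter, Finset.mem_univ, true_and] at hr hs
    exact Idx.ext' hrs (by omega)
  · intro j hj
    rw [Finset.mem_Ico] at hj
    have := p.one_le
    have := p.le
    refine ⟨⟨(j, j + 1), mk_mem_pairs.2 (by omega)⟩, ?_, rfl⟩
    simp only [Finset.mem_filter, Finset.mem_univ, true_and]
    omega
  · intro r hr
    simp only [Finset.mem_filter, Finset.mem_univ, true_and] at hr
    rw [hr.1, neg_sub]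

end Index

/-! ### Derivations of `T(n)` in coordinates -/

section Coefficients

variable {F : Type*} [Field F] {n : ℕ}

/-- The coefficients of `[v, N_{ik}]`, if `v` is the family of coefficients of an element
of `T(n)`. -/
def bracketCoeff (i k : ℕ) (v : ℕ → ℕ → F) (a b : ℕ) : F :=
  (if b = k then v a i else 0) - (if a = i then v k b else 0)

/-- `V j a b` behaves like the coefficient at `N_{ab}` of `D N_{j(j+1)}`, for a derivation `D` of
`T(n)`: the fields express that `D` respects the relations `[N_{j(j+1)}, N_{m(m+1)}] = 0` for
`j + 2 ≤ m`, `[N_{j(j+1)}, N_{j(j+2)}] = 0` and `[N_{(j+1)(j+2)}, N_{j(j+2)}] = 0`. -/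
structure IsDerivationCoeff (n : ℕ) (V : ℕ → ℕ → ℕ → F) : Prop where
  support : ∀ j a b, ¬ (1 ≤ a ∧ a < b ∧ b ≤ n) → V j a b = 0
  far : ∀ j m, 1 ≤ j → j + 2 ≤ m → m + 1 ≤ n → ∀ a b,
    bracketCoeff m (m + 1) (V j) a b = bracketCoeff j (j + 1) (V m) a b
  serre_left : ∀ j, 1 ≤ j → j + 2 ≤ n → ∀ a b, bracketCoeff j (j + 2) (V j) a b =
    bracketCoeff j (j + 1) (fun a b => bracketCoeff (j + 1) (j + 2) (V j) a b -
      bracketCoeff j (j + 1) (V (j + 1)) a b) a b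
  serre_right : ∀ j, 1 ≤ j → j + 2 ≤ n → ∀ a b, bracketCoeff j (j + 2) (V (j + 1)) a b =
    bracketCoeff (j + 1) (j + 2) (fun a b => bracketCoeff (j + 1) (j + 2) (V j) a b -
      bracketCoeff j (j + 1) (V (j + 1)) a b) a b

variable {V : ℕ → ℕ → ℕ → F}

/-- The coefficients that inner derivations can change belong to one common element of `T(n)`. -/
theorem IsDerivationCoeff.coherent (H : IsDerivationCoeff n V) {i k : ℕ} (hi : 1 ≤ i)
    (hik : i + 1 < k) (hk : k + 1 ≤ n) : V k (i + 1) (k + 1) = -V i i k := by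
  have h := H.far i k hi (by omega) hk i (k + 1)
  simp only [bracketCoeff, ↓reduceIte] at h
  rw [if_neg (by omega), if_neg (by omega)] at h
  linear_combination h

/-- If `N_{b(b+1)}`, whose bracket with `N_{ab}` is nonzero, commutes with `N_{j(j+1)}`, then
`N_{ab}` does not occur in `D N_{j(j+1)}`. -/
theorem IsDerivationCoeff.eq_zero_right (H : IsDerivationCoeff n V) {j a b : ℕ} (hj : 1 ≤ j)
    (hjn : j + 1 ≤ n) (haj : a ≠ j) (ha : 1 ≤ a) (hab : a < b) (hb : b + 1 ≤ n)
    (hbj : b + 2 ≤ j ∨ j + 2 ≤ b) : V j a b = 0 := by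
  rcases hbj with hbj | hbj
  · have h := H.far b j (by omega) hbj hjn a (b + 1)
    simp only [bracketCoeff, ↓reduceIte] at h
    rw [if_neg (by omega), if_neg (by omega), if_neg (by omega)] at h
    linear_combination -h
  · have h := H.far j b hj hbj hb a (b + 1)
    simp only [bracketCoeff, ↓reduceIte] at h
    rw [if_neg (by omega), if_neg (by omega), if_neg (by omega)] at h
    linear_combination h

/-- If `N_{a(a+1)}`, whose bracket with `N_{(a+1)b}` is nonzero, commutes with `N_{j(j+1)}`, then
`N_{(a+1)b}` does not occur in `D N_{j(j+1)}`. -/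
theorem IsDerivationCoeff.eq_zero_left (H : IsDerivationCoeff n V) {j a b : ℕ} (hj : 1 ≤ j)
    (hjn : j + 1 ≤ n) (hbj : b ≠ j + 1) (ha : 1 ≤ a) (hab : a + 1 < b) (hb : b ≤ n)
    (haj : a + 2 ≤ j ∨ j + 2 ≤ a) : V j (a + 1) b = 0 := by
  rcases haj with haj | haj
  · have h := H.far a j ha haj hjn a b
    simp only [bracketCoeff, ↓reduceIte] at h
    rw [if_neg (by omega), if_neg (by omega), if_neg (by omega)] at h
    linear_combination h
  · have h := H.far j a hj haj (by omega) a b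
    simp only [bracketCoeff, ↓reduceIte] at h
    rw [if_neg (by omega), if_neg (by omega), if_neg (by omega)] at h
    linear_combination -h

variable [CharZero F]

/-- Apart from the exceptional position, a derivation changes `N_{j(j+1)}` only within row `j` and
column `j + 1`. -/
theorem IsDerivationCoeff.eq_zero (H : IsDerivationCoeff n V) {j a b : ℕ} (hj : 1 ≤ j)
    (hjn : j + 1 ≤ n) (haj : a ≠ j) (hbj : b ≠ j + 1) (hab : (a, b) ≠ exceptional n j) :
    V j a b = 0 := by
  by_cases hv : 1 ≤ a ∧ a < b ∧ b ≤ n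
  swap
  · exact H.support j a b hv
  obtain ⟨ha, hlt, hb⟩ := hv
  by_cases hfar : b + 1 ≤ n ∧ (b + 2 ≤ j ∨ j + 2 ≤ b)
  · exact H.eq_zero_right hj hjn haj ha hlt hfar.1 hfar.2
  by_cases hfar' : 2 ≤ a ∧ (a + 1 ≤ j ∨ j + 3 ≤ a)
  · obtain ⟨a, rfl⟩ : ∃ c, a = c + 1 := ⟨a - 1, by omega⟩
    exact H.eq_zero_left hj hjn hbj (by omega) hlt hb (by omega)
  by_cases h1 : b + 1 = j
  · -- the relation `[N_{j(j+1)}, N_{(j-1)(j+1)}] = 0` yields twice the coefficient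
    subst h1
    have h := H.serre_right b (by omega) (by omega) a (b + 2)
    simp only [bracketCoeff, ↓reduceIte] at h
    rw [if_neg (by omega), if_neg (by omega), if_neg (by omega),
      if_neg (by omega), if_neg (by omega)] at h
    have : (2 : F) * V (b + 1) a b = 0 := by linear_combination h
    simpa using this
  by_cases h2 : b = j
  · subst h2
    have ha1 : a = 1 := by omega
    have hbn : b + 1 ≠ n := by
      rintro rfl
      apply hab
      rw [exceptional, if_neg (by omega), if_pos rfl, ha1]
      rfl
    have h := H.serre_left b hj (by omega) a (b + 2)
    simp only [bracketCoeff, ↓reduceIte] at h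
    rw [if_neg (by omega), if_neg (by omega), if_neg (by omega)] at h
    linear_combination h
  have hbn : b = n := by omega
  by_cases h3 : a = j + 2
  · subst h3
    have h := H.serre_left j hj (by omega) j b
    simp only [bracketCoeff, ↓reduceIte] at h
    rw [if_neg (by omega), if_neg (by omega), if_neg (by omega),
      if_neg (by omega), if_neg (by omega)] at h
    have : (2 : F) * V j (j + 2) b = 0 := by linear_combination -h
    simpa using this
  by_cases h4 : a = j + 1
  · subst h4
    have hj1 : j ≠ 1 := by
      rintro rfl
      apply hab
      rw [exceptional, if_pos rfl, hbn]
    obtain ⟨i, rfl⟩ : ∃ c, j = c + 1 := ⟨j - 1, by omega⟩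
    have h := H.serre_right i (by omega) (by omega) i b
    simp only [bracketCoeff, ↓reduceIte] at h
    rw [if_neg (by omega), if_neg (by omega), if_neg (by omega)] at h
    linear_combination -h
  exfalso
  apply hab
  rw [exceptional, if_neg (by omega), if_neg (by omega)]
  ext <;> simp only <;> omega

/-- The coefficients of the element `r` of `T(n)` such that `D - [r, ·]` is in normal form. -/
def innerCoeff (n : ℕ) (V : ℕ → ℕ → ℕ → F) (i k : ℕ) : F :=
  if k + 1 ≤ n then V k i (k + 1) else if 2 ≤ i then -V (i - 1) (i - 1) n else 0

/-- After subtracting the inner derivation with coefficients `innerCoeff`, only the diagonal and the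
exceptional coefficients are left. -/
theorem IsDerivationCoeff.sub_inner (H : IsDerivationCoeff n V) {r : ℕ → ℕ → F}
    (hr : ∀ i k, 1 ≤ i → i < k → k ≤ n → r i k = innerCoeff n V i k)
    (hr0 : ∀ i k, ¬ (1 ≤ i ∧ i < k ∧ k ≤ n) → r i k = 0) {j a b : ℕ} (hj : 1 ≤ j)
    (hjn : j + 1 ≤ n) (hab : (a, b) ≠ (j, j + 1)) (hex : (a, b) ≠ exceptional n j) :
    V j a b - bracketCoeff j (j + 1) r a b = 0 := by
  by_cases hv : 1 ≤ a ∧ a < b ∧ b ≤ n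
  swap
  · rw [H.support j a b hv, bracketCoeff]
    have h1 : (if b = j + 1 then r a j else 0) = 0 := by
      split_ifs with h
      · exact hr0 _ _ (by omega)
      · rfl
    have h2 : (if a = j then r (j + 1) b else 0) = 0 := by
      split_ifs with h
      · exact hr0 _ _ (by omega)
      · rfl
    rw [h1, h2]; ring
  obtain ⟨ha, hlt, hb⟩ := hv
  rw [bracketCoeff]
  by_cases haj : a = j
  · subst haj
    have hbj : b ≠ a + 1 := by rintro rfl; exact hab rfl
    rw [if_neg hbj, if_pos rfl, hr _ _ (by omega) (by omega) hb, innerCoeff]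
    split_ifs with h1 h2
    · rw [H.coherent ha (by omega) h1]; ring
    · have : b = n := by omega
      simp [this]
    · omega
  · rw [if_neg haj]
    by_cases hbj : b = j + 1
    · subst hbj
      rw [if_pos rfl, hr _ _ ha (by omega) (by omega), innerCoeff, if_pos hjn]; ring
    · rw [if_neg hbj, H.eq_zero hj hjn haj hbj hex]; ring

end Coefficients

/-! ### Coordinates with respect to an adapted basis -/

section Frame

variable {F : Type*} [Field F] {L : Type*} [AddCommGroup L] [Module F L] {n f : ℕ}

/-- The span of the basis vectors `N_{ik} = b (inr ik)`. -/
def nilSpan (b : Module.Basis (Fin f ⊕ Idx n) F L) : Submodule F L :=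
  Submodule.span F (Set.range fun p : Idx n => b (.inr p))

/-- The basis vector `N_{ik}`, and `0` if `(i, k)` is not an index. -/
noncomputable def elt (b : Module.Basis (Fin f ⊕ Idx n) F L) (i k : ℕ) : L :=
  if h : (i, k) ∈ pairs n then b (.inr ⟨(i, k), h⟩) else 0

/-- The coefficient at `N_{ik}`, and `0` if `(i, k)` is not an index. -/
noncomputable def coeff (b : Module.Basis (Fin f ⊕ Idx n) F L) (i k : ℕ) : L →ₗ[F] F :=
  if h : (i, k) ∈ pairs n then b.coord (.inr ⟨(i, k), h⟩) else 0

/-- A Leibniz algebra with a basis whose part `N_{ik}` spans an ideal and satisfies the relations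
of `T(n)`. -/
structure IsFrame (br : L →ₗ[F] L →ₗ[F] L) (b : Module.Basis (Fin f ⊕ Idx n) F L) : Prop where
  leibniz : IsLeibniz br
  ideal : IsIdeal br (nilSpan b)
  rel : TriangularRelations br fun p : Idx n => b (.inr p)

variable {br : L →ₗ[F] L →ₗ[F] L} {b : Module.Basis (Fin f ⊕ Idx n) F L}

theorem elt_of_mem {i k : ℕ} (h : (i, k) ∈ pairs n) : elt b i k = b (.inr ⟨(i, k), h⟩) :=
  dif_pos h

theorem elt_idx (p : Idx n) : elt b p.1.1 p.1.2 = b (.inr p) := elt_of_mem p.2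

theorem mem_nilSpan (p : Idx n) : b (.inr p) ∈ nilSpan b := Submodule.subset_span ⟨p, rfl⟩

theorem elt_mem (i k : ℕ) : elt b i k ∈ nilSpan b := by
  rw [elt]
  split_ifs with h
  · exact mem_nilSpan _
  · exact zero_mem _

theorem coeff_idx (p : Idx n) : coeff b p.1.1 p.1.2 = b.coord (.inr p) := dif_pos p.2

theorem coeff_of_not {i k : ℕ} (h : ¬ (1 ≤ i ∧ i < k ∧ k ≤ n)) (x : L) : coeff b i k x = 0 := by
  rw [coeff, dif_neg (by rwa [mk_mem_pairs])]; rfl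

theorem coeff_elt {i k a c : ℕ} (h : (a, c) ∈ pairs n) :
    coeff b i k (elt b a c) = if i = a ∧ k = c then 1 else 0 := by
  rw [elt_of_mem h, coeff]
  split_ifs with h1 h2 h2
  · obtain ⟨rfl, rfl⟩ := h2
    simp
  · rw [Module.Basis.coord_apply, Module.Basis.repr_self, Finsupp.single_eq_of_ne]
    intro h3
    simp only [Sum.inr.injEq, Subtype.mk.injEq, Prod.mk.injEq] at h3
    exact h2 h3
  · obtain ⟨rfl, rfl⟩ := h2
    exact absurd h h1
  · rfl

theorem coeff_b_inr {i k : ℕ} (p : Idx n) :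
    coeff b i k (b (.inr p)) = if i = p.1.1 ∧ k = p.1.2 then 1 else 0 := by
  rw [← elt_idx, coeff_elt p.2]

theorem eq_sum_of_mem {x : L} (hx : x ∈ nilSpan b) :
    x = ∑ p : Idx n, coeff b p.1.1 p.1.2 x • b (.inr p) := by
  induction hx using Submodule.span_induction with
  | mem x hx =>
    obtain ⟨q, rfl⟩ := hx
    simp only [coeff_idx, Module.Basis.coord_apply, Module.Basis.repr_self]
    rw [Finset.sum_eq_single q]
    · simp
    · intro p _ hp
      rw [Finsupp.single_eq_of_ne, zero_smul]
      simpa using hp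
    · simp
  | zero => simp
  | add x y _ _ hx hy =>
    conv_lhs => rw [hx, hy]
    simp only [map_add, add_smul, Finset.sum_add_distrib]
  | smul c x _ hx =>
    conv_lhs => rw [hx]
    simp only [map_smul, smul_eq_mul, mul_smul, Finset.smul_sum]

theorem ext_of_mem {x y : L} (hx : x ∈ nilSpan b) (hy : y ∈ nilSpan b)
    (h : ∀ i k, coeff b i k x = coeff b i k y) : x = y := by
  rw [eq_sum_of_mem hx, eq_sum_of_mem hy]
  simp only [h]

theorem exists_coeff_eq (b : Module.Basis (Fin f ⊕ Idx n) F L) (r : ℕ → ℕ → F) :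
    ∃ x ∈ nilSpan b, ∀ i k, 1 ≤ i → i < k → k ≤ n → coeff b i k x = r i k := by
  refine ⟨∑ p : Idx n, r p.1.1 p.1.2 • b (.inr p),
    sum_mem fun p _ => Submodule.smul_mem _ _ (mem_nilSpan p), fun i k h1 h2 h3 => ?_⟩
  have hm : (i, k) ∈ pairs n := mk_mem_pairs.2 ⟨h1, h2, h3⟩
  simp only [map_sum, map_smul, smul_eq_mul, coeff_b_inr]
  rw [Finset.sum_eq_single ⟨(i, k), hm⟩]
  · simp
  · intro p _ hp
    rw [if_neg, mul_zero]
    rintro ⟨rfl, rfl⟩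
    exact hp rfl
  · simp

/-- Linear maps that agree on the `N_{ik}` agree on the nilradical. -/
theorem eq_on_nilSpan {M : Type*} [AddCommGroup M] [Module F M] {g g' : L →ₗ[F] M}
    (h : ∀ p : Idx n, g (b (.inr p)) = g' (b (.inr p))) {x : L} (hx : x ∈ nilSpan b) :
    g x = g' x := by
  have : Set.EqOn g g' (Set.range fun p : Idx n => b (.inr p)) := by
    rintro _ ⟨p, rfl⟩
    exact h p
  exact LinearMap.eqOn_span this hx

namespace IsFrame

variable (H : IsFrame br b)
include H

theorem br_elt {i k a c : ℕ} (h : 1 ≤ i ∧ i < k ∧ k ≤ n) (h' : 1 ≤ a ∧ a < c ∧ c ≤ n) :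
    br (elt b i k) (elt b a c) =
      (if k = a then elt b i c else 0) - (if c = i then elt b a k else 0) := by
  rw [elt_of_mem (mk_mem_pairs.2 h), elt_of_mem (mk_mem_pairs.2 h')]
  refine (H.rel _ _).trans ?_
  simp only
  congr 1
  · split_ifs with h1
    · rw [elt_of_mem (mk_mem_pairs.2 (by omega))]; rfl
    · rfl
  · split_ifs with h1
    · rw [elt_of_mem (mk_mem_pairs.2 (by omega))]; rfl
    · rfl

theorem br_left_mem (x : L) {r : L} (hr : r ∈ nilSpan b) : br x r ∈ nilSpan b :=
  (H.ideal x r hr).1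

theorem br_right_mem (x : L) {r : L} (hr : r ∈ nilSpan b) : br r x ∈ nilSpan b :=
  (H.ideal x r hr).2

theorem antisymm {r s : L} (hr : r ∈ nilSpan b) (hs : s ∈ nilSpan b) : br r s = -br s r := by
  have h1 : ∀ p q : Idx n, br (b (.inr p)) (b (.inr q)) = -br (b (.inr q)) (b (.inr p)) := by
    intro p q
    refine (H.rel p q).trans ?_
    rw [show br (b (.inr q)) (b (.inr p)) = _ from H.rel q p, neg_sub]
  have h2 : ∀ p : Idx n, br (b (.inr p)) s = -br s (b (.inr p)) := by
    intro p
    exact eq_on_nilSpan (g := br (b (.inr p))) (g' := -br.flip (b (.inr p)))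
      (fun q => by simpa using h1 p q) hs
  exact eq_on_nilSpan (g := br.flip s) (g' := -br s) (fun q => by simpa using h2 q) hr

/-- The coordinates of a bracket with a basis vector `N_{ik}`. -/
theorem coeff_br {r : L} (hr : r ∈ nilSpan b) {i k : ℕ} (h : 1 ≤ i ∧ i < k ∧ k ≤ n)
    (a c : ℕ) :
    coeff b a c (br r (elt b i k)) = bracketCoeff i k (fun a c => coeff b a c r) a c := by
  have key : ∀ p : Idx n, coeff b a c (br (b (.inr p)) (elt b i k)) =
      bracketCoeff i k (fun a c => coeff b a c (b (.inr p))) a c := by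
    intro p
    obtain ⟨⟨u, v⟩, hp⟩ := p
    have hp' := mk_mem_pairs.1 hp
    rw [← elt_of_mem hp, H.br_elt hp' h, map_sub, bracketCoeff]
    simp only [coeff_elt hp]
    congr 1
    · by_cases h1 : v = i
      · subst h1
        rw [if_pos rfl, coeff_elt (mk_mem_pairs.2 (by omega))]
        split_ifs <;> first | rfl | omega
      · rw [if_neg h1, map_zero]
        split_ifs <;> first | rfl | omega
    · by_cases h1 : k = u
      · subst h1
        rw [if_pos rfl, coeff_elt (mk_mem_pairs.2 (by omega))]
        split_ifs <;> first | rfl | omega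
      · rw [if_neg h1, map_zero]
        split_ifs <;> first | rfl | omega
  have := eq_on_nilSpan (b := b) (g := (coeff b a c).comp (br.flip (elt b i k)))
    (g' := (if c = k then coeff b a i else 0) - (if a = i then coeff b k c else 0))
    (fun p => by
      refine (key p).trans ?_
      rw [bracketCoeff, LinearMap.sub_apply]
      congr 1 <;> split_ifs <;> rfl) hr
  refine this.trans ?_
  rw [bracketCoeff, LinearMap.sub_apply]
  congr 1 <;> split_ifs <;> rfl

theorem br_br (x y z : L) : br (br x y) z = br x (br y z) - br y (br x z) := by
  rw [H.leibniz x y z]; abel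

/-- Left multiplication acts on `T(n)` as a derivation. -/
theorem isDerivationCoeff (x : L) :
    IsDerivationCoeff n fun j a c => coeff b a c (br x (elt b j (j + 1))) := by
  have hr : ∀ i k, br x (elt b i k) ∈ nilSpan b := fun i k => H.br_left_mem x (elt_mem i k)
  have hcomm : ∀ i k j l a c, (1 ≤ i ∧ i < k ∧ k ≤ n) → (1 ≤ j ∧ j < l ∧ l ≤ n) →
      coeff b a c (br x (br (elt b i k) (elt b j l))) =
        bracketCoeff j l (fun a c => coeff b a c (br x (elt b i k))) a c -
        bracketCoeff i k (fun a c => coeff b a c (br x (elt b j l))) a c := by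
    intro i k j l a c h1 h2
    rw [H.leibniz x, map_add, H.coeff_br (hr _ _) h2, H.antisymm (elt_mem i k) (hr j l), map_neg,
      H.coeff_br (hr _ _) h1, ← sub_eq_add_neg]
  have hU : ∀ j a c, 1 ≤ j → j + 2 ≤ n → coeff b a c (br x (elt b j (j + 2))) =
      bracketCoeff (j + 1) (j + 2) (fun a c => coeff b a c (br x (elt b j (j + 1)))) a c -
      bracketCoeff j (j + 1) (fun a c => coeff b a c (br x (elt b (j + 1) (j + 2)))) a c := by
    intro j a c h1 h2
    rw [← hcomm j (j + 1) (j + 1) (j + 2) a c (by omega) (by omega),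
      H.br_elt (by omega) (by omega), if_pos rfl, if_neg (by omega), sub_zero]
  refine ⟨fun j a c h => coeff_of_not h _, ?_, ?_, ?_⟩
  · intro j m h1 h2 h3 a c
    have := hcomm j (j + 1) m (m + 1) a c (by omega) (by omega)
    rw [H.br_elt (by omega) (by omega), if_neg (by omega), if_neg (by omega), sub_zero, map_zero,
      map_zero] at this
    linear_combination -this
  · intro j h1 h2 a c
    have := hcomm j (j + 1) j (j + 2) a c (by omega) (by omega)
    rw [H.br_elt (by omega) (by omega), if_neg (by omega), if_neg (by omega), sub_zero, map_zero,
      map_zero] at this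
    simp only [hU _ _ _ h1 h2] at this
    linear_combination -this
  · intro j h1 h2 a c
    have := hcomm (j + 1) (j + 2) j (j + 2) a c (by omega) (by omega)
    rw [H.br_elt (by omega) (by omega), if_neg (by omega), if_neg (by omega), sub_zero, map_zero,
      map_zero] at this
    simp only [hU _ _ _ h1 h2] at this
    linear_combination -this

/-- An element of the nilradical that commutes with all generators, up to exceptional terms, is a
multiple of `N_{1n}`. -/
theorem eq_smul_corner (hn : 4 ≤ n) {z : L} (hz : z ∈ nilSpan b)
    (h : ∀ j, 1 ≤ j → j + 1 ≤ n → ∀ a c, (a, c) ≠ exceptional n j →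
      coeff b a c (br z (elt b j (j + 1))) = 0) :
    z = coeff b 1 n z • b (.inr (Idx.corner hn)) := by
  have hc : b (.inr (Idx.corner hn)) = elt b 1 n := (elt_idx _).symm
  rw [hc]
  refine ext_of_mem hz (Submodule.smul_mem _ _ (elt_mem _ _)) fun i k => ?_
  rw [map_smul, smul_eq_mul, coeff_elt (mk_mem_pairs.2 (by omega))]
  by_cases hv : 1 ≤ i ∧ i < k ∧ k ≤ n
  swap
  · rw [coeff_of_not hv, if_neg (by omega), mul_zero]
  by_cases hk : k + 1 ≤ n
  · have h1 := h k (by omega) hk i (k + 1) (by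
      rw [exceptional]; split_ifs <;> simp only [ne_eq, Prod.mk.injEq] <;> omega)
    rw [H.coeff_br hz (by omega), bracketCoeff, if_pos rfl, if_neg (by omega), sub_zero] at h1
    rw [h1, if_neg (by omega), mul_zero]
  by_cases hi : i = 1
  · rw [if_pos ⟨hi, by omega⟩, hi, mul_one, show k = n by omega]
  obtain ⟨i, rfl⟩ : ∃ l, i = l + 1 := ⟨i - 1, by omega⟩
  have h1 := h i (by omega) (by omega) i k (by
    rw [exceptional]; split_ifs <;> simp only [ne_eq, Prod.mk.injEq] <;> omega)
  rw [H.coeff_br hz (by omega), bracketCoeff, if_neg (by omega), if_pos rfl] at h1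
  rw [if_neg (by omega), mul_zero]
  linear_combination -h1

end IsFrame

/-! ### Normal form of left multiplications -/

/-- The coefficient at `N_{j(j+1)}` of `[x, N_{j(j+1)}]`, as a function of `x`. -/
noncomputable def weight (br : L →ₗ[F] L →ₗ[F] L) (b : Module.Basis (Fin f ⊕ Idx n) F L) (j : ℕ) :
    L →ₗ[F] F :=
  (coeff b j (j + 1)).comp (br.flip (elt b j (j + 1)))

/-- Potentials of the weights: `x` acts on `N_{ik}`, up to off-diagonal terms, by
`potential i x - potential k x`. -/
noncomputable def potential (br : L →ₗ[F] L →ₗ[F] L) (b : Module.Basis (Fin f ⊕ Idx n) F L)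
    (i : ℕ) : L →ₗ[F] F :=
  ∑ j ∈ Finset.Ico i n, weight br b j

theorem weight_apply (j : ℕ) (x : L) :
    weight br b j x = coeff b j (j + 1) (br x (elt b j (j + 1))) := rfl

theorem potential_sub {j : ℕ} (hj : j + 1 ≤ n) (x : L) :
    potential br b j x - potential br b (j + 1) x = weight br b j x := by
  rw [potential, Finset.sum_eq_sum_Ico_succ_bot (by omega), LinearMap.add_apply]
  simp [potential]

namespace IsFrame

variable (H : IsFrame br b)
include H

theorem weight_of_mem {r : L} (hr : r ∈ nilSpan b) {j : ℕ} (hj : 1 ≤ j) (hjn : j + 1 ≤ n) :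
    weight br b j r = 0 := by
  rw [weight_apply, H.coeff_br hr (by omega), bracketCoeff, coeff_of_not (by omega),
    coeff_of_not (by omega)]
  simp

/-- The normal form on the generators extends to all of `T(n)`. -/
theorem br_elt_of_generators (hn : 4 ≤ n) {y : L} {m : ℕ → F}
    (hy : ∀ j, 1 ≤ j → j + 1 ≤ n → br y (elt b j (j + 1)) = weight br b j y • elt b j (j + 1) +
      m j • elt b (exceptional n j).1 (exceptional n j).2) {i : ℕ} (hi : 1 ≤ i) (l : ℕ)
    (hl : i + 2 + l ≤ n) : br y (elt b i (i + 2 + l)) =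
      (potential br b i y - potential br b (i + 2 + l) y) • elt b i (i + 2 + l) := by
  -- `N_{i(k+1)} = [N_{ik}, N_{k(k+1)}]`, and the exceptional terms are killed
  have hstep : ∀ k, i < k → k + 1 ≤ n → elt b i (k + 1) = br (elt b i k) (elt b k (k + 1)) := by
    intro k h1 h2
    rw [H.br_elt (by omega) (by omega), if_pos rfl, if_neg (by omega), sub_zero]
  have hright : ∀ k, i < k → k + 1 ≤ n →
      br (elt b i k) (elt b (exceptional n k).1 (exceptional n k).2) = 0 := by
    intro k h1 h2
    have h3 := mem_pairs.1 (exceptional_mem hn k)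
    rw [H.br_elt (by omega) h3]
    rw [if_neg, if_neg, sub_zero]
    · rw [exceptional]; split_ifs <;> simp only <;> omega
    · rw [exceptional]; split_ifs <;> simp only <;> omega
  induction l with
  | zero =>
    have h3 := mem_pairs.1 (exceptional_mem hn i)
    have hleft : br (elt b (exceptional n i).1 (exceptional n i).2) (elt b (i + 1) (i + 1 + 1)) =
        0 := by
      rw [H.br_elt h3 (by omega)]
      rw [if_neg, if_neg, sub_zero]
      · rw [exceptional]; split_ifs <;> simp only <;> omega
      · rw [exceptional]; split_ifs <;> simp only <;> omega
    have h1 := hstep (i + 1) (by omega) (by omega)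
    have h2 := potential_sub (br := br) (b := b) (j := i) (by omega) y
    have h4 := potential_sub (br := br) (b := b) (j := i + 1) (by omega) y
    rw [add_zero]
    change br y (elt b i (i + 1 + 1)) = (_ - potential br b (i + 1 + 1) y) • elt b i (i + 1 + 1)
    rw [h1, H.leibniz, hy i hi (by omega), hy (i + 1) (by omega) (by omega)]
    simp only [map_add, map_smul, LinearMap.add_apply, LinearMap.smul_apply, hleft,
      hright (i + 1) (by omega) (by omega), smul_zero, add_zero]
    rw [← add_smul, ← h2, ← h4]
    congr 1
    ring
  | succ l ih =>
    have h1 := hstep (i + 2 + l) (by omega) (by omega)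
    have h4 := potential_sub (br := br) (b := b) (j := i + 2 + l) (by omega) y
    change br y (elt b i (i + 2 + l + 1)) =
      (_ - potential br b (i + 2 + l + 1) y) • elt b i (i + 2 + l + 1)
    rw [h1, H.leibniz, ih (by omega), hy (i + 2 + l) (by omega) (by omega)]
    simp only [map_add, map_smul, LinearMap.smul_apply, hright (i + 2 + l) (by omega) (by omega),
      smul_zero, add_zero]
    rw [← add_smul, ← h4]
    congr 1
    ring

/-- Modulo inner derivations, every left multiplication acts in normal form. -/
theorem exists_normal [CharZero F] (hn : 4 ≤ n) (x : L) : ∃ r ∈ nilSpan b, ∃ m : Idx n → F,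
    (∀ p, ¬ p.Simple → m p = 0) ∧ ∀ p : Idx n, br (x - r) (b (.inr p)) =
      (potential br b p.1.1 x - potential br b p.1.2 x) • b (.inr p) +
        m p • b (.inr (p.target hn)) := by
  obtain ⟨r, hr, hrc⟩ := exists_coeff_eq b
    (innerCoeff n fun j a c => coeff b a c (br x (elt b j (j + 1))))
  have hw : ∀ j, 1 ≤ j → j + 1 ≤ n → weight br b j (x - r) = weight br b j x := by
    intro j h1 h2
    rw [map_sub, H.weight_of_mem hr h1 h2, sub_zero]
  have hpot : ∀ i k, 1 ≤ i → i ≤ k →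
      potential br b i (x - r) - potential br b k (x - r) =
        potential br b i x - potential br b k x := by
    have h : ∀ i, 1 ≤ i → potential br b i (x - r) = potential br b i x := by
      intro i hi
      simp only [potential, LinearMap.sum_apply]
      refine Finset.sum_congr rfl fun j hj => ?_
      rw [Finset.mem_Ico] at hj
      exact hw j (by omega) (by omega)
    intro i k h1 h2
    rw [h i h1, h k (by omega)]
  let m : ℕ → F := fun j =>
    coeff b (exceptional n j).1 (exceptional n j).2 (br (x - r) (elt b j (j + 1)))
  have hgen : ∀ j, 1 ≤ j → j + 1 ≤ n → br (x - r) (elt b j (j + 1)) =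
      weight br b j (x - r) • elt b j (j + 1) +
        m j • elt b (exceptional n j).1 (exceptional n j).2 := by
    intro j h1 h2
    have hjj : (j, j + 1) ∈ pairs n := mk_mem_pairs.2 (by omega)
    have hex : ((exceptional n j).1, (exceptional n j).2) ∈ pairs n := exceptional_mem hn j
    have hne : ¬ (j = (exceptional n j).1 ∧ j + 1 = (exceptional n j).2) := by
      rw [exceptional]; split_ifs <;> simp only <;> omega
    refine ext_of_mem (H.br_left_mem _ (elt_mem _ _)) (add_mem
      (Submodule.smul_mem _ _ (elt_mem _ _)) (Submodule.smul_mem _ _ (elt_mem _ _))) fun a c => ?_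
    rw [map_add, map_smul, map_smul, coeff_elt hjj, coeff_elt hex, smul_eq_mul, smul_eq_mul]
    by_cases hac : a = j ∧ c = j + 1
    · obtain ⟨rfl, rfl⟩ := hac
      rw [if_pos ⟨rfl, rfl⟩, if_neg hne, mul_one, mul_zero, add_zero]
      rfl
    by_cases hac' : a = (exceptional n j).1 ∧ c = (exceptional n j).2
    · rw [if_neg hac, if_pos hac', mul_zero, mul_one, zero_add, hac'.1, hac'.2]
    rw [if_neg hac, if_neg hac', mul_zero, mul_zero, add_zero, map_sub, LinearMap.sub_apply,
      map_sub, H.coeff_br hr (by omega)]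
    refine (H.isDerivationCoeff x).sub_inner hrc (fun i k h => coeff_of_not h _) h1 h2 ?_ ?_
    · simpa using hac
    · intro h
      exact hac' ⟨congrArg Prod.fst h, congrArg Prod.snd h⟩
  refine ⟨r, hr, fun p => if p.Simple then m p.1.1 else 0, fun p hp => if_neg hp, fun p => ?_⟩
  have h1 := p.one_le
  have h2 := p.lt
  have h3 := p.le
  rw [← hpot _ _ h1 h2.le, ← elt_idx, ← elt_idx]
  beta_reduce
  by_cases hp : p.Simple
  · rw [if_pos hp, show p.1.2 = p.1.1 + 1 from hp, potential_sub (by omega)]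
    exact hgen _ h1 (by omega)
  · rw [if_neg hp, zero_smul, add_zero]
    obtain ⟨l, hl⟩ : ∃ l, p.1.2 = p.1.1 + 2 + l := ⟨p.1.2 - p.1.1 - 2, by
      have : p.1.2 ≠ p.1.1 + 1 := hp
      omega⟩
    rw [hl]
    exact H.br_elt_of_generators hn hgen h1 l (by omega)

/-! ### The weights detect the nilradical -/

/-- Modulo `[T(n), T(n)]`, left multiplications act diagonally. -/
theorem coeff_simple_br [CharZero F] (hn : 4 ≤ n) (x : L) {s : L} (hs : s ∈ nilSpan b) {j : ℕ}
    (hj : 1 ≤ j) (hjn : j + 1 ≤ n) :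
    coeff b j (j + 1) (br x s) = weight br b j x * coeff b j (j + 1) s := by
  obtain ⟨r, hr, m, -, h⟩ := H.exists_normal hn x
  refine eq_on_nilSpan (g := (coeff b j (j + 1)).comp (br x))
    (g' := weight br b j x • coeff b j (j + 1)) (fun p => ?_) hs
  have h1 := p.one_le
  have h2 := p.lt
  have h3 := p.le
  have hx : br x (b (.inr p)) = br (x - r) (b (.inr p)) + br r (b (.inr p)) := by
    rw [map_sub, LinearMap.sub_apply, sub_add_cancel]
  have hrp : coeff b j (j + 1) (br r (b (.inr p))) = 0 := by
    rw [← elt_idx, H.coeff_br hr (by omega), bracketCoeff]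
    have e1 : (if j + 1 = p.1.2 then coeff b j p.1.1 r else 0) = 0 := by
      split_ifs
      · exact coeff_of_not (by omega) r
      · rfl
    have e2 : (if j = p.1.1 then coeff b p.1.2 (j + 1) r else 0) = 0 := by
      split_ifs
      · exact coeff_of_not (by omega) r
      · rfl
    rw [e1, e2, sub_zero]
  have ht : ¬ (j = (p.target hn).1.1 ∧ j + 1 = (p.target hn).1.2) := by
    rintro ⟨e1, e2⟩
    exact Idx.not_simple_target hn p (show _ = _ by rw [← e1, ← e2])
  rw [LinearMap.comp_apply, hx, map_add, hrp, add_zero, h, map_add, map_smul, map_smul,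
    LinearMap.smul_apply, coeff_b_inr, coeff_b_inr, if_neg ht, smul_zero, add_zero]
  by_cases hp : j = p.1.1 ∧ j + 1 = p.1.2
  · obtain ⟨rfl, e2⟩ := hp
    rw [← e2, potential_sub hjn]
  · rw [if_neg hp, smul_zero, smul_zero]

/-- Left multiplications act on `T(n)` modulo `[T(n), T(n)]` by commuting operators, so products
have vanishing weights. -/
theorem weight_br [CharZero F] (hn : 4 ≤ n) (x y : L) {j : ℕ} (hj : 1 ≤ j) (hjn : j + 1 ≤ n) :
    weight br b j (br x y) = 0 := by
  have hm : elt b j (j + 1) ∈ nilSpan b := elt_mem _ _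
  rw [weight_apply, H.br_br, map_sub, H.coeff_simple_br hn x (H.br_left_mem y hm) hj hjn,
    H.coeff_simple_br hn y (H.br_left_mem x hm) hj hjn, H.coeff_simple_br hn y hm hj hjn,
    H.coeff_simple_br hn x hm hj hjn]
  ring

end IsFrame

/-- The elements all of whose weights vanish. -/
noncomputable def weightKer (br : L →ₗ[F] L →ₗ[F] L) (b : Module.Basis (Fin f ⊕ Idx n) F L) :
    Submodule F L :=
  ⨅ j ∈ Finset.Ico 1 n, LinearMap.ker (weight br b j)

theorem mem_weightKer {x : L} :
    x ∈ weightKer br b ↔ ∀ j, 1 ≤ j → j + 1 ≤ n → weight br b j x = 0 := by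
  simp only [weightKer, Submodule.mem_iInf, Finset.mem_Ico, LinearMap.mem_ker, and_imp]
  rfl

/-- The span of the `N_{ik}` with `k - i ≥ m`. -/
def level (b : Module.Basis (Fin f ⊕ Idx n) F L) (m : ℕ) : Submodule F L :=
  Submodule.span F {y | ∃ p : Idx n, p.1.1 + m ≤ p.1.2 ∧ b (.inr p) = y}

theorem mem_level {m : ℕ} (p : Idx n) (h : p.1.1 + m ≤ p.1.2) : b (.inr p) ∈ level b m :=
  Submodule.subset_span ⟨p, h, rfl⟩

theorem elt_mem_level {m i k : ℕ} (h : i + m ≤ k) : elt b i k ∈ level b m := by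
  rw [elt]
  split_ifs with h1
  · exact mem_level _ h
  · exact zero_mem _

theorem nilSpan_le_level : nilSpan b ≤ level b 1 := by
  refine Submodule.span_le.2 ?_
  rintro _ ⟨p, rfl⟩
  exact mem_level p p.lt

theorem level_le_nilSpan (m : ℕ) : level b m ≤ nilSpan b := by
  refine Submodule.span_le.2 ?_
  rintro _ ⟨p, -, rfl⟩
  exact mem_nilSpan p

theorem level_eq_bot {m : ℕ} (hm : n ≤ m) : level b m = ⊥ := by
  refine Submodule.span_eq_bot.2 ?_
  rintro _ ⟨p, h, rfl⟩
  have h1 := p.one_le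
  have h3 := p.le
  omega

theorem IsLeibniz.isIdeal_map₂ {br : L →ₗ[F] L →ₗ[F] L} (hL : IsLeibniz br) {I : Submodule F L}
    (hI : IsIdeal br I) : IsIdeal br (Submodule.map₂ br I I) := by
  intro x y hy
  constructor
  · have : Submodule.map₂ br I I ≤ (Submodule.map₂ br I I).comap (br x) := by
      refine Submodule.map₂_le.2 fun u hu v hv => ?_
      rw [Submodule.mem_comap, hL]
      exact add_mem (Submodule.apply_mem_map₂ _ (hI x u hu).1 hv)
        (Submodule.apply_mem_map₂ _ hu (hI x v hv).1)
    exact this hy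
  · have : Submodule.map₂ br I I ≤ (Submodule.map₂ br I I).comap (br.flip x) := by
      refine Submodule.map₂_le.2 fun u hu v hv => ?_
      have h : br (br u v) x = br u (br v x) - br v (br u x) := by rw [hL u v x]; abel
      rw [Submodule.mem_comap, LinearMap.flip_apply, h]
      exact sub_mem (Submodule.apply_mem_map₂ _ hu (hI x v hv).2)
        (Submodule.apply_mem_map₂ _ hv (hI x u hu).2)
    exact this hy

theorem IsLeibniz.isIdeal_derivedSeries {br : L →ₗ[F] L →ₗ[F] L} (hL : IsLeibniz br) (k : ℕ) :
    IsIdeal br (derivedSeries br k) := by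
  induction k with
  | zero => exact fun x y _ => ⟨Submodule.mem_top, Submodule.mem_top⟩
  | succ k ih => exact hL.isIdeal_map₂ ih

theorem IsIdeal.inf {br : L →ₗ[F] L →ₗ[F] L} {I J : Submodule F L} (hI : IsIdeal br I)
    (hJ : IsIdeal br J) : IsIdeal br (I ⊓ J) :=
  fun x y hy => ⟨⟨(hI x y hy.1).1, (hJ x y hy.2).1⟩, ⟨(hI x y hy.1).2, (hJ x y hy.2).2⟩⟩

theorem IsIdeal.sup {br : L →ₗ[F] L →ₗ[F] L} {I J : Submodule F L} (hI : IsIdeal br I)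
    (hJ : IsIdeal br J) : IsIdeal br (I ⊔ J) := by
  intro x y hy
  obtain ⟨u, hu, v, hv, rfl⟩ := Submodule.mem_sup.1 hy
  rw [map_add, map_add, LinearMap.add_apply]
  exact ⟨Submodule.add_mem_sup (hI x u hu).1 (hJ x v hv).1,
    Submodule.add_mem_sup (hI x u hu).2 (hJ x v hv).2⟩

namespace IsFrame

variable (H : IsFrame br b)
include H

theorem nilSpan_le_weightKer : nilSpan b ≤ weightKer br b :=
  fun _ hr => mem_weightKer.2 fun _ h1 h2 => H.weight_of_mem hr h1 h2

/-- Elements with vanishing weights act strictly triangularly on `T(n)`. -/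
theorem br_mem_level [CharZero F] (hn : 4 ≤ n) {x : L} (hx : x ∈ weightKer br b) {m : ℕ}
    {s : L} (hs : s ∈ level b m) : br x s ∈ level b (m + 1) := by
  rw [mem_weightKer] at hx
  obtain ⟨r, hr, c, hc, h⟩ := H.exists_normal hn x
  have hpot : ∀ i, 1 ≤ i → potential br b i x = 0 := by
    intro i hi
    rw [potential, LinearMap.sum_apply]
    refine Finset.sum_eq_zero fun j hj => ?_
    rw [Finset.mem_Ico] at hj
    exact hx j (by omega) (by omega)
  suffices hle : level b m ≤ (level b (m + 1)).comap (br x) from hle hs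
  refine Submodule.span_le.2 ?_
  rintro _ ⟨p, hp, rfl⟩
  have h1 := p.one_le
  have h2 := p.lt
  have h3 := p.le
  have hxr : br x (b (.inr p)) = br (x - r) (b (.inr p)) + br r (b (.inr p)) := by
    rw [map_sub, LinearMap.sub_apply, sub_add_cancel]
  change br x (b (.inr p)) ∈ level b (m + 1)
  rw [hxr, h, hpot _ h1, hpot _ (by omega), sub_zero, zero_smul, zero_add]
  refine add_mem ?_ ?_
  · by_cases hsimple : p.Simple
    · refine Submodule.smul_mem _ _ (mem_level _ ?_)
      have e : p.1.2 = p.1.1 + 1 := hsimple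
      simp only [Idx.target, exceptional]
      split_ifs <;> simp only <;> omega
    · rw [hc p hsimple, zero_smul]
      exact zero_mem _
  · have hle : nilSpan b ≤ (level b (m + 1)).comap (br.flip (b (.inr p))) := by
      refine Submodule.span_le.2 ?_
      rintro _ ⟨q, rfl⟩
      have h1' := q.one_le
      have h2' := q.lt
      have h3' := q.le
      change br (b (.inr q)) (b (.inr p)) ∈ level b (m + 1)
      rw [← elt_idx, ← elt_idx, H.br_elt (by omega) (by omega)]
      refine sub_mem ?_ ?_
      · split_ifs
        · exact elt_mem_level (by omega)
        · exact zero_mem _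
      · split_ifs
        · exact elt_mem_level (by omega)
        · exact zero_mem _
    exact hle hr

/-- A subspace of elements with vanishing weights whose products lie in `T(n)` is nilpotent. -/
theorem isNilpotent_of_le [CharZero F] (hn : 4 ≤ n) {J : Submodule F L}
    (hJ : J ≤ weightKer br b) (hJJ : Submodule.map₂ br J J ≤ nilSpan b) :
    IsNilpotentSubalgebra br J := by
  have key : ∀ k, lowerCentralSeries br J (k + 1) ≤ level b (k + 1) := by
    intro k
    induction k with
    | zero => exact hJJ.trans nilSpan_le_level
    | succ k ih =>
      refine Submodule.map₂_le.2 fun u hu v hv => ?_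
      exact H.br_mem_level hn (hJ hu) (ih hv)
  exact ⟨n + 1, eq_bot_iff.2 ((key n).trans (level_eq_bot n.le_succ).le)⟩

/-- In a solvable algebra the nilradical is the common kernel of the weights. If `S` is this
kernel and `D_k` the derived series, then `S ⊓ D_k ⊔ T(n)` is a nilpotent ideal as soon as
`S ⊓ D_{k+1} ≤ T(n)`; this allows one to descend to `D_0 = L`. -/
theorem weightKer_le [CharZero F] (hn : 4 ≤ n) (hsol : IsSolvable br)
    (hrad : IsNilradical br (nilSpan b)) : weightKer br b ≤ nilSpan b := by
  obtain ⟨K, hK⟩ := hsol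
  have hS : IsIdeal br (weightKer br b) := fun x y _ =>
    ⟨mem_weightKer.2 fun _ h1 h2 => H.weight_br hn _ _ h1 h2,
      mem_weightKer.2 fun _ h1 h2 => H.weight_br hn _ _ h1 h2⟩
  have key : ∀ l k, k + l = K → weightKer br b ⊓ derivedSeries br k ≤ nilSpan b := by
    intro l
    induction l with
    | zero =>
      intro k hk
      rw [show k = K from hk, hK]
      simp
    | succ l ih =>
      intro k hk
      have hI : IsIdeal br (weightKer br b ⊓ derivedSeries br k) :=
        hS.inf (H.leibniz.isIdeal_derivedSeries k)
      have hII : Submodule.map₂ br (weightKer br b ⊓ derivedSeries br k)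
          (weightKer br b ⊓ derivedSeries br k) ≤ nilSpan b := by
        refine le_trans (Submodule.map₂_le.2 fun u hu v hv => ?_) (ih (k + 1) (by omega))
        exact ⟨(hS u v hv.1).1, Submodule.apply_mem_map₂ _ hu.2 hv.2⟩
      refine le_trans le_sup_left (hrad.2 ⟨hI.sup H.ideal, H.isNilpotent_of_le hn
        (sup_le inf_le_left H.nilSpan_le_weightKer) ?_⟩)
      rw [Submodule.map₂_sup_left, Submodule.map₂_sup_right]
      refine sup_le (sup_le hII ?_) ?_
      · exact Submodule.map₂_le.2 fun u _ v hv => H.br_left_mem u hv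
      · exact Submodule.map₂_le.2 fun u hu v _ => H.br_right_mem v hu
  have := key K 0 (zero_add K)
  rwa [derivedSeries, inf_top_eq] at this

end IsFrame

/-! ### Adapted bases -/

theorem exists_adapted_basis [FiniteDimensional F L] {N : Idx n → L}
    (hN : LinearIndependent F N) :
    ∃ (f : ℕ) (b : Module.Basis (Fin f ⊕ Idx n) F L), ∀ p, b (.inr p) = N p := by
  refine ⟨_, (Module.Basis.sumQuot (Module.Basis.span hN)
    (Module.finBasis F (L ⧸ Submodule.span F (Set.range N)))).reindex (Equiv.sumComm _ _),
    fun p => ?_⟩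
  simp [Module.Basis.span_apply]

/-- A basis may be changed by the map `1 + E` if `E ^ 2 = 0`. -/
theorem exists_basis_add {ι : Type*} (b : Module.Basis ι F L) (g : ι → L)
    (hg : ∀ i, b.constr F g (g i) = 0) : ∃ b' : Module.Basis ι F L, ∀ i, b' i = b i + g i := by
  set E := b.constr F g with hE
  have hEb : ∀ i, E (b i) = g i := fun i => b.constr_basis F g i
  have hEE : ∀ x, E (E x) = 0 := by
    intro x
    have : E.comp E = 0 := b.ext fun i => by simp [hEb, hg]
    exact LinearMap.congr_fun this x
  refine ⟨b.map (LinearEquiv.ofLinearMap (LinearMap.id + E) (LinearMap.id - E) ?_ ?_), fun i => ?_⟩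
  · ext x; simp [hEE]
  · ext x; simp [hEE]
  · simp [hEb]

theorem repr_inl_of_mem {x : L} (hx : x ∈ nilSpan b) (α : Fin f) : b.repr x (.inl α) = 0 := by
  refine eq_on_nilSpan (g := b.coord (.inl α)) (g' := 0) (fun p => ?_) hx
  simp

theorem elt_corner (hn : 4 ≤ n) : elt b 1 n = b (.inr (Idx.corner hn)) :=
  elt_idx (Idx.corner hn)

namespace IsFrame

variable (H : IsFrame br b)
include H

theorem br_corner (hn : 4 ≤ n) {r : L} (hr : r ∈ nilSpan b) :
    br r (b (.inr (Idx.corner hn))) = 0 := by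
  refine eq_on_nilSpan (g := br.flip (b (.inr (Idx.corner hn)))) (g' := 0) (fun p => ?_) hr
  have h1 := p.one_le
  have h2 := p.lt
  have h3 := p.le
  rw [LinearMap.flip_apply, ← elt_idx, ← elt_corner hn, H.br_elt (by omega) (by omega),
    if_neg (by omega), if_neg (by omega), sub_zero]
  rfl

theorem corner_br (hn : 4 ≤ n) {r : L} (hr : r ∈ nilSpan b) :
    br (b (.inr (Idx.corner hn))) r = 0 := by
  rw [H.antisymm (mem_nilSpan _) hr, H.br_corner hn hr, neg_zero]

/-- Symmetrized products are left annihilators. -/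
theorem br_symm_br (x y z : L) : br (br x y + br y x) z = 0 := by
  rw [map_add, LinearMap.add_apply, H.br_br, H.br_br]
  abel

/-- Right multiplication on `T(n)` is minus left multiplication, up to multiples of `N_{1n}`. -/
theorem exists_br_right (hn : 4 ≤ n) (x : L) {r : L} (hr : r ∈ nilSpan b) :
    ∃ c : F, br r x = -br x r + c • b (.inr (Idx.corner hn)) := by
  refine ⟨_, eq_neg_add_iff_add_eq.2 ((add_comm _ _).trans (H.eq_smul_corner hn
    (add_mem (H.br_right_mem x hr) (H.br_left_mem x hr)) fun j _ _ a c _ => ?_))⟩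
  rw [H.br_symm_br, map_zero]

/-- On `[T(n), T(n)]`, right multiplication is exactly minus left multiplication. -/
theorem br_right_of_not_simple (hn : 4 ≤ n) (x : L) {p : Idx n} (hp : ¬ p.Simple) :
    br (b (.inr p)) x = -br x (b (.inr p)) := by
  have h1 := p.one_le
  have h2 := p.lt
  have h3 := p.le
  have h4 : p.1.2 ≠ p.1.1 + 1 := hp
  have hu : elt b p.1.1 (p.1.1 + 1) ∈ nilSpan b := elt_mem _ _
  have hv : elt b (p.1.1 + 1) p.1.2 ∈ nilSpan b := elt_mem _ _
  have hN : b (.inr p) = br (elt b p.1.1 (p.1.1 + 1)) (elt b (p.1.1 + 1) p.1.2) := by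
    rw [H.br_elt (by omega) (by omega), if_pos rfl, if_neg (by omega), sub_zero, elt_idx]
  obtain ⟨c, hc⟩ := H.exists_br_right hn x hu
  obtain ⟨d, hd⟩ := H.exists_br_right hn x hv
  rw [hN, H.br_br, hc, hd, H.leibniz x]
  simp only [map_add, map_neg, map_smul, H.br_corner hn hu, H.br_corner hn hv, smul_zero,
    add_zero]
  rw [H.antisymm (H.br_left_mem x hu) hv]
  abel

end IsFrame

/-! ### Extensions of `T(n)` in normal form -/

/-- `X^α = b (inl α)` acts on `N_{ik} = b (inr ik)` from the left by
`h α i - h α k`, apart from the terms `m α ik` at the exceptional positions, and from the right by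
the negative of this, up to terms `φ α ik` at `N_{1n}`; moreover `[X^α, X^β] = σ α β • N_{1n}`. -/
structure IsNormal (hn : 4 ≤ n) (br : L →ₗ[F] L →ₗ[F] L) (b : Module.Basis (Fin f ⊕ Idx n) F L)
    (h : Fin f → ℕ → F) (m φ : Fin f → Idx n → F) (σ : Fin f → Fin f → F) : Prop
    extends IsFrame br b where
  nilradical : IsNilradical br (nilSpan b)
  X_N : ∀ α p, br (b (.inl α)) (b (.inr p)) =
    (h α p.1.1 - h α p.1.2) • b (.inr p) + m α p • b (.inr (p.target hn))
  N_X : ∀ α p, br (b (.inr p)) (b (.inl α)) =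
    -br (b (.inl α)) (b (.inr p)) + φ α p • b (.inr (Idx.corner hn))
  X_X : ∀ α β, br (b (.inl α)) (b (.inl β)) = σ α β • b (.inr (Idx.corner hn))
  m_zero : ∀ α p, ¬ p.Simple → m α p = 0
  φ_zero : ∀ α p, ¬ p.Simple → φ α p = 0
  indep : ∀ c : Fin f → F,
    (∀ j, 1 ≤ j → j + 1 ≤ n → ∑ α, c α * (h α j - h α (j + 1)) = 0) → c = 0

/-- The normal form is reached by changing the `X^α` by elements of `T(n)`; the `[X^α, X^β]` and the
symmetrized products then commute with `T(n)` up to exceptional terms. -/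
theorem IsFrame.exists_isNormal [CharZero F] (H : IsFrame br b) (hn : 4 ≤ n)
    (hrad : IsNilradical br (nilSpan b)) (hker : weightKer br b ≤ nilSpan b) :
    ∃ (b' : Module.Basis (Fin f ⊕ Idx n) F L) (h : Fin f → ℕ → F) (m φ : Fin f → Idx n → F)
      (σ : Fin f → Fin f → F), IsNormal hn br b' h m φ σ := by
  choose r hr m hm hX using fun α : Fin f => H.exists_normal hn (b (.inl α))
  obtain ⟨b', hb'⟩ := exists_basis_add b (Sum.elim (fun α => -r α) fun _ => 0) (by
    rintro (α | p)
    · refine eq_on_nilSpan (g' := 0) (fun q => ?_) (neg_mem (hr α))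
      rw [Module.Basis.constr_basis]
      rfl
    · exact map_zero _)
  have hl : ∀ α, b' (.inl α) = b (.inl α) - r α := fun α => by
    rw [hb', Sum.elim_inl, sub_eq_add_neg]
  have hrr : ∀ p, b' (.inr p) = b (.inr p) := fun p => by rw [hb', Sum.elim_inr, add_zero]
  have hspan : nilSpan b' = nilSpan b := by simp only [nilSpan, hrr]
  have H' : IsFrame br b' := ⟨H.leibniz, hspan ▸ H.ideal, by simpa only [hrr] using H.rel⟩
  let h : Fin f → ℕ → F := fun α i => potential br b i (b (.inl α))
  have hXN : ∀ α p, br (b' (.inl α)) (b' (.inr p)) =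
      (h α p.1.1 - h α p.1.2) • b' (.inr p) + m α p • b' (.inr (p.target hn)) := by
    intro α p
    rw [hl, hrr, hrr, hX]
  have hNX : ∀ α p, ∃ φ : F, br (b' (.inr p)) (b' (.inl α)) =
      -br (b' (.inl α)) (b' (.inr p)) + φ • b' (.inr (Idx.corner hn)) :=
    fun α p => H'.exists_br_right hn _ (mem_nilSpan p)
  choose φ hφ using hNX
  have hXX : ∀ α β, ∃ σ : F, br (b' (.inl α)) (b' (.inl β)) = σ • b' (.inr (Idx.corner hn)) := by
    intro α β
    have hmem : br (b' (.inl α)) (b' (.inl β)) ∈ nilSpan b' := hspan ▸ hker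
      (mem_weightKer.2 fun j h1 h2 => H.weight_br hn _ _ h1 h2)
    refine ⟨_, H'.eq_smul_corner hn hmem fun j h1 h2 a c hac => ?_⟩
    have hj : elt b' j (j + 1) = b' (.inr ⟨(j, j + 1), mk_mem_pairs.2 (by omega)⟩) :=
      elt_of_mem _
    have h3 : ∀ α, m α (Idx.target hn ⟨(j, j + 1), mk_mem_pairs.2 (by omega)⟩) = 0 :=
      fun α => hm α _ (Idx.not_simple_target hn _)
    have h4 : coeff b' a c
        (b' (.inr (Idx.target hn ⟨(j, j + 1), mk_mem_pairs.2 (by omega)⟩))) = 0 := by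
      rw [coeff_b_inr]
      exact if_neg fun h => hac (Prod.ext h.1 h.2)
    rw [H'.br_br, hj, hXN, hXN]
    simp only [map_add, map_sub, map_smul, hXN, h3, h4, smul_eq_mul]
    ring
  choose σ hσ using hXX
  refine ⟨b', h, m, fun α p => if p.Simple then φ α p else 0, σ, H', hspan ▸ hrad, hXN, ?_, hσ,
    hm, fun α p hp => if_neg hp, ?_⟩
  · intro α p
    by_cases hp : p.Simple
    · simp only [if_pos hp, hφ]
    · simp only [if_neg hp, zero_smul, add_zero]
      exact H'.br_right_of_not_simple hn _ hp
  · intro c hc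
    have hx : ∑ α, c α • b (.inl α) ∈ nilSpan b := by
      refine hker (mem_weightKer.2 fun j h1 h2 => ?_)
      rw [map_sum, ← hc j h1 h2]
      refine Finset.sum_congr rfl fun α _ => ?_
      rw [map_smul, smul_eq_mul, ← potential_sub h2]
    funext α
    have := repr_inl_of_mem hx α
    rw [map_sum, Finset.sum_apply'] at this
    simpa [Finsupp.single_apply] using this

namespace IsNormal

variable {hn : 4 ≤ n} {h : Fin f → ℕ → F} {m φ : Fin f → Idx n → F} {σ : Fin f → Fin f → F}
variable (H : IsNormal hn br b h m φ σ)
include H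

theorem X_corner (α : Fin f) : br (b (.inl α)) (b (.inr (Idx.corner hn))) =
    (h α 1 - h α n) • b (.inr (Idx.corner hn)) := by
  rw [H.X_N, H.m_zero _ _ (Idx.not_simple_corner hn), zero_smul, add_zero]
  rfl

theorem corner_X (α : Fin f) : br (b (.inr (Idx.corner hn))) (b (.inl α)) =
    -((h α 1 - h α n) • b (.inr (Idx.corner hn))) := by
  rw [H.N_X, H.φ_zero _ _ (Idx.not_simple_corner hn), zero_smul, add_zero, H.X_corner]

theorem X_target (α : Fin f) (p : Idx n) : br (b (.inl α)) (b (.inr (p.target hn))) =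
    (h α (p.target hn).1.1 - h α (p.target hn).1.2) • b (.inr (p.target hn)) := by
  rw [H.X_N, H.m_zero _ _ (Idx.not_simple_target hn p), zero_smul, add_zero]

/-- Since the `[X^α, X^β]` are central in `T(n)`, the left multiplications commute on `T(n)`. -/
theorem X_X_N (α β : Fin f) (p : Idx n) : br (b (.inl α)) (br (b (.inl β)) (b (.inr p))) =
    br (b (.inl β)) (br (b (.inl α)) (b (.inr p))) := by
  rw [H.leibniz, H.X_X, map_smul, LinearMap.smul_apply, H.corner_br hn (mem_nilSpan p), smul_zero,
    zero_add]

/-- The left multiplication by `X^β` commutes on `T(n)` with the right multiplication by `X^α`. -/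
theorem X_N_X (α β : Fin f) (p : Idx n) : br (b (.inl β)) (br (b (.inr p)) (b (.inl α))) =
    br (br (b (.inl β)) (b (.inr p))) (b (.inl α)) := by
  rw [H.leibniz, H.X_X, map_smul, H.br_corner hn (mem_nilSpan p), smul_zero, add_zero]

/-- The coefficient at `N_{target}` of the commutation relation `X_X_N`: if one weight difference is
nonzero, the `m α p` are proportional to the weight differences. -/
theorem m_mul (α β : Fin f) (p : Idx n) :
    m α p * ((h β p.1.1 - h β p.1.2) - (h β (p.target hn).1.1 - h β (p.target hn).1.2)) =
    m β p * ((h α p.1.1 - h α p.1.2) - (h α (p.target hn).1.1 - h α (p.target hn).1.2)) := by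
  by_cases hp : p.Simple
  swap
  · rw [H.m_zero α p hp, H.m_zero β p hp]; ring
  have h1 := congrArg (fun x => b.repr x (.inr (p.target hn))) (H.X_X_N α β p)
  have hne : p ≠ p.target hn := (Idx.target_ne hn hp).symm
  simp only [H.X_N, map_add, map_smul, H.m_zero _ _ (Idx.not_simple_target hn p), zero_smul,
    add_zero, Finsupp.add_apply, Finsupp.smul_apply, Module.Basis.repr_self, smul_eq_mul,
    Finsupp.single_eq_same] at h1
  rw [Finsupp.single_eq_of_ne (by simpa using hne.symm)] at h1
  linear_combination h1

/-- The coefficient at `N_{1n}` of the commutation relation `X_N_X`. -/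
theorem φ_mul (α β : Fin f) (p : Idx n) :
    φ α p * ((h β p.1.1 - h β p.1.2) - (h β 1 - h β n)) = 0 := by
  have h1 := H.X_N_X α β p
  have h2 : br (br (b (.inl β)) (b (.inr p))) (b (.inl α)) =
      -br (b (.inl β)) (br (b (.inl α)) (b (.inr p))) +
        ((h β p.1.1 - h β p.1.2) * φ α p) • b (.inr (Idx.corner hn)) := by
    rw [H.X_X_N β α, H.X_N β p]
    simp only [map_add, map_smul, LinearMap.add_apply, LinearMap.smul_apply, H.N_X,
      H.φ_zero _ _ (Idx.not_simple_target hn p), zero_smul, add_zero, smul_add, mul_smul,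
      smul_neg]
    abel
  rw [h2, H.N_X α p, map_add, map_neg, map_smul, H.X_corner, smul_smul] at h1
  have h3 := congrArg (fun x => b.repr x (.inr (Idx.corner hn))) (add_left_cancel h1)
  simp only [map_smul, Finsupp.smul_apply, Module.Basis.repr_self, smul_eq_mul,
    Finsupp.single_eq_same, mul_one] at h3
  linear_combination -h3

/-- The element `φ α p • N_{1n}` is a symmetrized product, hence a left annihilator; but `N_{1n}`
does not annihilate `X^γ`. -/
theorem φ_eq_zero {γ : Fin f} (hγ : h γ 1 - h γ n ≠ 0) (α : Fin f) (p : Idx n) : φ α p = 0 := by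
  have h1 := H.br_symm_br (b (.inr p)) (b (.inl α)) (b (.inl γ))
  rw [H.N_X, add_right_comm, neg_add_cancel, zero_add, map_smul, LinearMap.smul_apply, H.corner_X,
    smul_neg, smul_smul, neg_eq_zero, smul_eq_zero] at h1
  rcases h1 with h1 | h1
  · exact (mul_eq_zero.1 h1).resolve_right hγ
  · exact absurd h1 (b.ne_zero _)

/-- The element `(σ α β + σ β α) • N_{1n}` is a symmetrized product, hence a left annihilator. -/
theorem σ_antisymm {γ : Fin f} (hγ : h γ 1 - h γ n ≠ 0) (α β : Fin f) : σ α β = -σ β α := by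
  have h1 := H.br_symm_br (b (.inl α)) (b (.inl β)) (b (.inl γ))
  rw [H.X_X, H.X_X, ← add_smul, map_smul, LinearMap.smul_apply, H.corner_X,
    smul_neg, smul_smul, neg_eq_zero, smul_eq_zero] at h1
  rcases h1 with h1 | h1
  · exact eq_neg_of_add_eq_zero_left ((mul_eq_zero.1 h1).resolve_right hγ)
  · exact absurd h1 (b.ne_zero _)

end IsNormal

/-! ### Changes of basis -/

variable {b' : Module.Basis (Fin f ⊕ Idx n) F L}

theorem IsFrame.target_br (H : IsFrame br b) (hn : 4 ≤ n) {p q : Idx n} (hp : p.Simple)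
    (hpq : q ≠ p) : br (b (.inr (p.target hn))) (b (.inr q)) = 0 := by
  have h1 := p.one_le
  have h3 := p.le
  have h1' := q.one_le
  have h2' := q.lt
  have h3' := q.le
  have hp' : p.1.2 = p.1.1 + 1 := hp
  have hne : ¬ (q.1.1 = p.1.1 ∧ q.1.2 = p.1.2) := fun h => hpq (Idx.ext' h.1 h.2)
  have ht := mem_pairs.1 (p.target hn).2
  rw [← elt_idx, ← elt_idx, H.br_elt ht (by omega), if_neg, if_neg, sub_zero]
  · simp only [Idx.target, exceptional]
    split_ifs <;> simp only <;> omega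
  · simp only [Idx.target, exceptional]
    split_ifs <;> simp only <;> omega

theorem IsFrame.target_target (H : IsFrame br b) (hn : 4 ≤ n) {p : Idx n} (hp : p.Simple)
    (q : Idx n) : br (b (.inr (p.target hn))) (b (.inr (q.target hn))) = 0 :=
  H.target_br hn hp fun h => Idx.not_simple_target hn q (h.symm ▸ hp)

/-- The change of basis `N_{j(j+1)} ↦ N_{j(j+1)} + t N_{target}` preserves the relations
of `T(n)`. -/
theorem IsFrame.of_add_target [CharZero F] (H : IsFrame br b) (hn : 4 ≤ n) {t : Idx n → F}
    (ht : ∀ p, ¬ p.Simple → t p = 0) (hspan : nilSpan b' = nilSpan b)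
    (hb' : ∀ p, b' (.inr p) = b (.inr p) + t p • b (.inr (p.target hn))) : IsFrame br b' := by
  refine ⟨H.leibniz, hspan ▸ H.ideal, fun p q => ?_⟩
  have hns : ∀ p, ¬ p.Simple → b' (.inr p) = b (.inr p) := fun p hp => by
    rw [hb', ht p hp, zero_smul, add_zero]
  have hjoin : ∀ (p q : Idx n) (h : p.1.2 = q.1.1), b' (.inr (p.join q h)) =
      b (.inr (p.join q h)) := fun p q h => hns _ fun h' => by
    have e : q.1.2 = p.1.1 + 1 := h'
    have := p.lt
    have := q.lt
    omega
  have h0 : ∀ p q : Idx n, q ≠ p → t p • br (b (.inr (p.target hn))) (b (.inr q)) = 0 := by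
    intro p q hpq
    by_cases hp : p.Simple
    · rw [H.target_br hn hp hpq, smul_zero]
    · rw [ht p hp, zero_smul]
  have h00 : ∀ p q : Idx n, t p • br (b (.inr (p.target hn))) (b (.inr (q.target hn))) = 0 := by
    intro p q
    by_cases hp : p.Simple
    · rw [H.target_target hn hp, smul_zero]
    · rw [ht p hp, zero_smul]
  by_cases hpq : p = q
  · subst hpq
    have hself : br (b' (.inr p)) (b' (.inr p)) = 0 := by
      have hm : b' (.inr p) ∈ nilSpan b := hspan ▸ mem_nilSpan p
      have h2 : (2 : F) • br (b' (.inr p)) (b' (.inr p)) = 0 := by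
        rw [two_smul, ← eq_neg_iff_add_eq_zero]
        exact H.antisymm hm hm
      exact (smul_eq_zero.1 h2).resolve_left two_ne_zero
    have := p.lt
    rw [dif_neg (by omega), sub_zero]
    exact hself
  · simp only [hjoin]
    refine Eq.trans ?_ (H.rel p q)
    have e : br (b (.inr p)) (b (.inr (q.target hn))) =
        -br (b (.inr (q.target hn))) (b (.inr p)) := H.antisymm (mem_nilSpan _) (mem_nilSpan _)
    simp only [hb', map_add, map_smul, LinearMap.add_apply, LinearMap.smul_apply, e]
    rw [h0 p q (Ne.symm hpq), h00 p q, add_zero, add_zero, smul_neg, h0 q p hpq, neg_zero, add_zero]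

namespace IsNormal

variable {hn : 4 ≤ n} {h : Fin f → ℕ → F} {m φ : Fin f → Idx n → F} {σ : Fin f → Fin f → F}

/-- The off-diagonal terms `m` between different weights can be removed. -/
theorem exists_reduced [CharZero F] (H : IsNormal hn br b h m φ σ) :
    ∃ (b' : Module.Basis (Fin f ⊕ Idx n) F L) (m' : Fin f → Idx n → F),
      IsNormal hn br b' h m' φ σ ∧ ∀ p : Idx n,
        (∃ β, h β p.1.1 - h β p.1.2 ≠ h β (p.target hn).1.1 - h β (p.target hn).1.2) →
          ∀ α, m' α p = 0 := by
  classical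
  -- by `m_mul`, one change of `N_p` removes the term for all `α` simultaneously
  have hex : ∀ p : Idx n, ∃ t : F, (¬ p.Simple → t = 0) ∧
      ((∃ β, h β p.1.1 - h β p.1.2 ≠ h β (p.target hn).1.1 - h β (p.target hn).1.2) → ∀ α,
        m α p + t * ((h α (p.target hn).1.1 - h α (p.target hn).1.2) - (h α p.1.1 - h α p.1.2)) =
          0) := by
    intro p
    by_cases hp : ∃ β, h β p.1.1 - h β p.1.2 ≠ h β (p.target hn).1.1 - h β (p.target hn).1.2
    · obtain ⟨β, hβ⟩ := hp
      refine ⟨m β p / ((h β p.1.1 - h β p.1.2) -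
        (h β (p.target hn).1.1 - h β (p.target hn).1.2)), fun hs => ?_, fun _ α => ?_⟩
      · rw [H.m_zero β p hs, zero_div]
      · have h1 := H.m_mul α β p
        have h2 := sub_ne_zero.2 hβ
        generalize (h β p.1.1 - h β p.1.2) - (h β (p.target hn).1.1 - h β (p.target hn).1.2) = w
          at h1 h2
        field_simp
        linear_combination h1
    · exact ⟨0, fun _ => rfl, fun h' => absurd h' hp⟩
  choose t ht htm using hex
  obtain ⟨b', hb'⟩ := exists_basis_add b
    (Sum.elim (fun _ => 0) fun p => t p • b (.inr (p.target hn))) (by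
      rintro (α | p)
      · exact map_zero _
      · rw [Sum.elim_inr, map_smul, Module.Basis.constr_basis, Sum.elim_inr,
          ht _ (Idx.not_simple_target hn p), zero_smul, smul_zero])
  have hl : ∀ α, b' (.inl α) = b (.inl α) := fun α => by rw [hb', Sum.elim_inl, add_zero]
  have hr : ∀ p, b' (.inr p) = b (.inr p) + t p • b (.inr (p.target hn)) := fun p => hb' _
  have hns : ∀ p, ¬ p.Simple → b' (.inr p) = b (.inr p) := fun p hp => by
    rw [hr, ht p hp, zero_smul, add_zero]
  have hspan : nilSpan b' = nilSpan b := by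
    refine le_antisymm (Submodule.span_le.2 ?_) (Submodule.span_le.2 ?_)
    · rintro _ ⟨p, rfl⟩
      simp only [hr]
      exact add_mem (mem_nilSpan _) (Submodule.smul_mem _ _ (mem_nilSpan _))
    · rintro _ ⟨p, rfl⟩
      have e : b (.inr p) = b' (.inr p) - t p • b' (.inr (p.target hn)) := by
        rw [hns _ (Idx.not_simple_target hn p), hr, add_sub_cancel_right]
      simp only [e]
      exact sub_mem (mem_nilSpan _) (Submodule.smul_mem _ _ (mem_nilSpan _))
  have hc := hns _ (Idx.not_simple_corner hn)
  refine ⟨b', fun α p => m α p + t p * ((h α (p.target hn).1.1 - h α (p.target hn).1.2) -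
    (h α p.1.1 - h α p.1.2)), ?_, htm⟩
  refine
    { toIsFrame := H.toIsFrame.of_add_target hn ht hspan hr
      nilradical := hspan ▸ H.nilradical
      X_N := fun α p => ?_
      N_X := fun α p => ?_
      X_X := fun α β => ?_
      m_zero := fun α p hp => ?_
      φ_zero := H.φ_zero
      indep := H.indep }
  · rw [hns _ (Idx.not_simple_target hn p), hl, hr, map_add, map_smul, H.X_target, H.X_N]
    module
  · rw [hl, hr, hc, map_add, map_smul, map_add, map_smul, LinearMap.add_apply,
      LinearMap.smul_apply, H.N_X, H.N_X, H.φ_zero _ _ (Idx.not_simple_target hn p)]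
    module
  · rw [hl, hl, hc, H.X_X]
  · rw [H.m_zero α p hp, ht p hp]
    ring

/-- If some `X^γ` does not commute with `N_{1n}`, then the `X^α` can be made to commute. -/
theorem exists_commuting [CharZero F] (H : IsNormal hn br b h m φ σ) {γ : Fin f}
    (hγ : h γ 1 - h γ n ≠ 0) :
    ∃ b' : Module.Basis (Fin f ⊕ Idx n) F L, IsNormal hn br b' h m φ fun _ _ => 0 := by
  set c : Fin f → F := fun α => -σ γ α / (h γ 1 - h γ n) with hcdef
  obtain ⟨b', hb'⟩ := exists_basis_add b
    (Sum.elim (fun α => c α • b (.inr (Idx.corner hn))) fun _ => 0) (by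
      rintro (α | p)
      · rw [Sum.elim_inl, map_smul, Module.Basis.constr_basis, Sum.elim_inr, smul_zero]
      · exact map_zero _)
  have hl : ∀ α, b' (.inl α) = b (.inl α) + c α • b (.inr (Idx.corner hn)) := fun α => hb' _
  have hr : ∀ p, b' (.inr p) = b (.inr p) := fun p => by rw [hb', Sum.elim_inr, add_zero]
  have hspan : nilSpan b' = nilSpan b := by simp only [nilSpan, hr]
  have hXX : ∀ α β, br (b' (.inl α)) (b' (.inl β)) =
      (σ α β + c β * (h α 1 - h α n) - c α * (h β 1 - h β n)) • b' (.inr (Idx.corner hn)) := by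
    intro α β
    simp only [hl, hr, map_add, map_smul, LinearMap.add_apply, LinearMap.smul_apply, H.X_X,
      H.X_corner, H.corner_X, H.br_corner hn (mem_nilSpan _)]
    module
  have hXN : ∀ α p, br (b' (.inl α)) (b' (.inr p)) =
      (h α p.1.1 - h α p.1.2) • b' (.inr p) + m α p • b' (.inr (p.target hn)) := by
    intro α p
    rw [hl, hr, hr, map_add, map_smul, LinearMap.add_apply, LinearMap.smul_apply,
      H.corner_br hn (mem_nilSpan p), H.X_N, smul_zero, add_zero]
  have hNX : ∀ α p, br (b' (.inr p)) (b' (.inl α)) =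
      -br (b' (.inl α)) (b' (.inr p)) + φ α p • b' (.inr (Idx.corner hn)) := by
    intro α p
    rw [hl, hr, hr, map_add, map_smul, map_add, map_smul, LinearMap.add_apply,
      LinearMap.smul_apply, H.corner_br hn (mem_nilSpan p), H.br_corner hn (mem_nilSpan p),
      H.N_X, smul_zero, add_zero, add_zero]
  have H' : IsNormal hn br b' h m φ
      (fun α β => σ α β + c β * (h α 1 - h α n) - c α * (h β 1 - h β n)) :=
    { leibniz := H.leibniz
      ideal := hspan ▸ H.ideal
      rel := by simpa only [hr] using H.rel
      nilradical := hspan ▸ H.nilradical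
      X_N := hXN
      N_X := hNX
      X_X := hXX
      m_zero := H.m_zero
      φ_zero := H.φ_zero
      indep := H.indep }
  have hσγ : c γ = 0 := by
    have : σ γ γ = 0 := self_eq_neg.1 (H.σ_antisymm hγ γ γ)
    simp [hcdef, this]
  have hγ0 : ∀ α, br (b' (.inl γ)) (b' (.inl α)) = 0 := by
    intro α
    rw [hXX, hσγ, hcdef]
    simp only
    rw [div_mul_cancel₀ _ hγ]
    simp
  have hzero : ∀ α β, br (b' (.inl α)) (b' (.inl β)) = 0 := by
    intro α β
    have h1 := H.leibniz (b' (.inl γ)) (b' (.inl α)) (b' (.inl β))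
    rw [hγ0, hγ0, map_zero, map_zero, LinearMap.zero_apply, add_zero, hXX, map_smul,
      H'.X_corner, smul_smul, smul_eq_zero] at h1
    rcases h1 with h1 | h1
    · rw [hXX, (mul_eq_zero.1 h1).resolve_right hγ, zero_smul]
    · exact absurd h1 (b'.ne_zero _)
  exact ⟨b', { H' with X_X := fun α β => by rw [hzero, zero_smul] }⟩

end IsNormal

/-! ### The canonical form -/

/-- The matrix of the left multiplication by an element in normal form. -/
def leftMatrix (hn : 4 ≤ n) (h : ℕ → F) (m : Idx n → F) : Matrix (Idx n) (Idx n) F :=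
  fun p q => (if q = p then h p.1.1 - h p.1.2 else 0) + (if q = p.target hn then m p else 0)

/-- The matrix of the corresponding right multiplication. -/
def rightMatrix (hn : 4 ≤ n) (h : ℕ → F) (m φ : Idx n → F) : Matrix (Idx n) (Idx n) F :=
  fun p q => -leftMatrix hn h m p q + (if q = Idx.corner hn then φ p else 0)

theorem sum_leftMatrix_smul (hn : 4 ≤ n) (h : ℕ → F) (m : Idx n → F) (p : Idx n) (v : Idx n → L) :
    ∑ q, leftMatrix hn h m p q • v q =
      (h p.1.1 - h p.1.2) • v p + m p • v (p.target hn) := by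
  simp only [leftMatrix, add_smul, Finset.sum_add_distrib, ite_smul, zero_smul,
    Finset.sum_ite_eq', Finset.mem_univ, if_true]

theorem sum_rightMatrix_smul (hn : 4 ≤ n) (h : ℕ → F) (m φ : Idx n → F) (p : Idx n)
    (v : Idx n → L) : ∑ q, rightMatrix hn h m φ p q • v q =
      -((h p.1.1 - h p.1.2) • v p + m p • v (p.target hn)) + φ p • v (Idx.corner hn) := by
  simp only [rightMatrix, add_smul, neg_smul, Finset.sum_add_distrib, Finset.sum_neg_distrib,
    sum_leftMatrix_smul, ite_smul, zero_smul, Finset.sum_ite_eq', Finset.mem_univ, if_true]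

section

variable {hn : 4 ≤ n} {h : ℕ → F} {m φ : Idx n → F}

theorem leftMatrix_self (hm : ∀ p, ¬ p.Simple → m p = 0) (p : Idx n) :
    leftMatrix hn h m p p = h p.1.1 - h p.1.2 := by
  rw [leftMatrix, if_pos rfl]
  by_cases hp : p.Simple
  · rw [if_neg (Idx.target_ne hn hp).symm, add_zero]
  · rw [hm p hp, ite_self, add_zero]

theorem leftMatrix_eq_zero (hm : ∀ p, ¬ p.Simple → m p = 0) {p q : Idx n} (hpq : p ≠ q)
    (h' : ¬ (p.Simple ∧ q = p.target hn)) : leftMatrix hn h m p q = 0 := by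
  rw [leftMatrix, if_neg hpq.symm, zero_add]
  by_cases hp : p.Simple
  · exact if_neg fun hq => h' ⟨hp, hq⟩
  · rw [hm p hp, ite_self]

theorem rightMatrix_eq_zero (hm : ∀ p, ¬ p.Simple → m p = 0) (hφ : ∀ p, ¬ p.Simple → φ p = 0)
    {p q : Idx n} (hpq : p ≠ q)
    (h' : ¬ (p.Simple ∧ (q = p.target hn ∨ q = Idx.corner hn))) :
    rightMatrix hn h m φ p q = 0 := by
  rw [rightMatrix, leftMatrix_eq_zero hm hpq fun h => h' ⟨h.1, .inl h.2⟩, neg_zero, zero_add]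
  by_cases hp : p.Simple
  · exact if_neg fun hq => h' ⟨hp, .inr hq⟩
  · rw [hφ p hp, ite_self]

theorem rightMatrix_self (hm : ∀ p, ¬ p.Simple → m p = 0) (hφ : ∀ p, ¬ p.Simple → φ p = 0)
    (p : Idx n) : rightMatrix hn h m φ p p = -(h p.1.1 - h p.1.2) := by
  rw [rightMatrix, leftMatrix_self hm]
  by_cases hp : p.Simple
  · rw [if_neg, add_zero]
    rintro rfl
    exact Idx.not_simple_corner hn hp
  · rw [hφ p hp, ite_self, add_zero]

theorem offDiagA_target {p : Idx n} (hp : p.Simple) : OffDiagA p (p.target hn) := by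
  have h1 := p.one_le
  have h3 := p.le
  obtain ⟨⟨i, k⟩, hik⟩ := p
  obtain rfl : k = i + 1 := hp
  simp only [OffDiagA, Idx.target, exceptional]
  simp only at h1 h3
  by_cases hi : i = 1
  · subst hi
    exact .inl ⟨rfl, if_pos rfl⟩
  by_cases hin : i + 1 = n
  · refine .inr (.inr ⟨?_, ?_⟩)
    · ext <;> simp only <;> omega
    · rw [if_neg hi, if_pos hin]
  · exact .inr (.inl ⟨i, by omega, by omega, rfl, by rw [if_neg hi, if_neg hin]⟩)

theorem offDiagB_target {p q : Idx n} (hp : p.Simple)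
    (hq : q = p.target hn ∨ q = Idx.corner hn) : OffDiagB p q := by
  rcases hq with rfl | rfl
  · rcases offDiagA_target (hn := hn) hp with h | ⟨j, h1, h2, h3⟩ | h
    · exact .inl h
    · exact .inr (.inl ⟨j, by omega, by omega, h3⟩)
    · exact .inr (.inr h)
  · have h1 := p.one_le
    have h3 := p.le
    have h2 : p.1.2 = p.1.1 + 1 := hp
    exact .inr (.inl ⟨p.1.1, h1, by omega, Prod.ext rfl h2, rfl⟩)

theorem position_lt_of_simple {p q : Idx n} (hp : p.Simple) (hq : ¬ q.Simple) :
    p.position < q.position := by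
  have h1 := q.lt
  have h2 : p.1.2 = p.1.1 + 1 := hp
  have h3 : q.1.2 ≠ q.1.1 + 1 := hq
  rw [Idx.position, Idx.position, Prod.Lex.toLex_lt_toLex]
  left
  simp only
  omega

theorem hasForm_of {P : Idx n → Idx n → Prop} {C : Matrix (Idx n) (Idx n) F} {g : ℕ → F}
    (h0 : ∀ p q, p ≠ q → ¬ (p.Simple ∧ (q = p.target hn ∨ q = Idx.corner hn)) → C p q = 0)
    (hP : ∀ p q, p ≠ q → ¬ P p q → C p q = 0) (hC : ∀ p, C p p = g p.1.1 - g p.1.2) :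
    HasForm P C where
  upper := by
    intro p q hpq
    refine h0 p q (by rintro rfl; exact lt_irrefl _ hpq) ?_
    rintro ⟨hp, rfl | rfl⟩
    · exact lt_asymm hpq (position_lt_of_simple hp (Idx.not_simple_target hn p))
    · exact lt_asymm hpq (position_lt_of_simple hp (Idx.not_simple_corner hn))
  offDiag := hP
  diag := by
    intro p
    simp only [hC, sum_simple_telescope]

theorem leftMatrix_hasForm (hm : ∀ p, ¬ p.Simple → m p = 0) :
    HasForm OffDiagA (leftMatrix hn h m) := by
  refine hasForm_of (hn := hn) (g := h) (fun p q hpq h' => leftMatrix_eq_zero hm hpq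
    fun h'' => h' ⟨h''.1, .inl h''.2⟩) (fun p q hpq h' => leftMatrix_eq_zero hm hpq ?_)
    (leftMatrix_self hm)
  rintro ⟨hp, rfl⟩
  exact h' (offDiagA_target hp)

theorem rightMatrix_hasForm (hm : ∀ p, ¬ p.Simple → m p = 0) (hφ : ∀ p, ¬ p.Simple → φ p = 0) :
    HasForm OffDiagB (rightMatrix hn h m φ) := by
  refine hasForm_of (hn := hn) (g := -h) (fun p q hpq h' => rightMatrix_eq_zero hm hφ hpq h')
    (fun p q hpq h' => rightMatrix_eq_zero hm hφ hpq fun h'' => h' (offDiagB_target h''.1 h''.2))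
    (fun p => ?_)
  rw [rightMatrix_self hm hφ]
  simp only [Pi.neg_apply]
  ring

end

/-- Matrices commute if the operators commute that they define on independent vectors. -/
theorem commute_of_smul_eq {ι : Type*} [Fintype ι] [DecidableEq ι] {v : ι → L}
    (hv : LinearIndependent F v) {A B : Matrix ι ι F}
    (h : ∀ p, ∑ r, A p r • ∑ q, B r q • v q = ∑ r, B p r • ∑ q, A r q • v q) : Commute A B := by
  have key : ∀ (A B : Matrix ι ι F) (p : ι),
      ∑ r, A p r • ∑ q, B r q • v q = ∑ q, (A * B) p q • v q := by
    intro A B p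
    simp only [Finset.smul_sum, Matrix.mul_apply, Finset.sum_smul, mul_smul]
    exact Finset.sum_comm
  ext p q
  have h1 := h p
  rw [key, key, ← sub_eq_zero, ← Finset.sum_sub_distrib] at h1
  simp only [← sub_smul] at h1
  exact sub_eq_zero.1 (Fintype.linearIndependent_iff.1 hv _ h1 q)

namespace IsNormal

variable {hn : 4 ≤ n} {h : Fin f → ℕ → F} {m φ : Fin f → Idx n → F} {σ : Fin f → Fin f → F}

theorem nilindependent (H : IsNormal hn br b h m φ σ) :
    Nilindependent fun α => leftMatrix hn (h α) (m α) := by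
  intro c hc
  refine H.indep c fun j h1 h2 => ?_
  -- the unit vector at a generator is an eigenvector
  let p : Idx n := ⟨(j, j + 1), mk_mem_pairs.2 (by omega)⟩
  have hp : p.Simple := rfl
  set T := ∑ α, c α • leftMatrix hn (h α) (m α) with hT
  set μ := ∑ α, c α * (h α j - h α (j + 1)) with hμ
  have hTp : T.mulVec (Pi.single p 1) = μ • Pi.single p 1 := by
    funext q
    rw [Matrix.mulVec_single_one, Pi.smul_apply, Matrix.col_apply, hT, Matrix.sum_apply,
      smul_eq_mul]
    by_cases hq : q = p
    · subst hq
      rw [Pi.single_eq_same, mul_one, hμ]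
      refine Finset.sum_congr rfl fun α _ => ?_
      rw [Matrix.smul_apply, leftMatrix_self (H.m_zero α), smul_eq_mul]
    · rw [Pi.single_eq_of_ne hq, mul_zero]
      refine Finset.sum_eq_zero fun α _ => ?_
      rw [Matrix.smul_apply, leftMatrix_eq_zero (H.m_zero α) hq, smul_zero]
      rintro ⟨-, h⟩
      exact Idx.not_simple_target hn q (h ▸ hp)
  obtain ⟨k, hk⟩ := hc
  have hpow : ∀ k, (T ^ k).mulVec (Pi.single p 1) = μ ^ k • Pi.single p 1 := by
    intro k
    induction k with
    | zero => rw [pow_zero, pow_zero, Matrix.one_mulVec, one_smul]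
    | succ k ih => rw [pow_succ, ← Matrix.mulVec_mulVec, hTp, Matrix.mulVec_smul, ih, smul_smul,
        pow_succ']
  have h3 := congrFun (hpow k) p
  rw [hk, Matrix.zero_mulVec, Pi.zero_apply, Pi.smul_apply, Pi.single_eq_same, smul_eq_mul,
    mul_one] at h3
  exact IsReduced.eq_zero _ ⟨k, h3.symm⟩

/-- The linear map sending coefficients `c` to the weights of `∑ c α • X^α`. -/
def weightMap (n : ℕ) (h : Fin f → ℕ → F) : (Fin f → F) →ₗ[F] (Fin (n - 1) → F) where
  toFun c j := ∑ α, c α * (h α (j + 1) - h α (j + 1 + 1))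
  map_add' c d := by
    funext j
    simp only [Pi.add_apply, add_mul, Finset.sum_add_distrib]
  map_smul' c d := by
    funext j
    simp only [Pi.smul_apply, smul_eq_mul, mul_assoc, Finset.mul_sum, RingHom.id_apply]

theorem weightMap_injective (H : IsNormal hn br b h m φ σ) :
    Function.Injective (weightMap n h) := by
  rw [← LinearMap.ker_eq_bot, LinearMap.ker_eq_bot']
  intro c hc
  refine H.indep c fun j h1 h2 => ?_
  have := congrFun hc ⟨j - 1, by omega⟩
  simp only [weightMap, LinearMap.coe_mk, AddHom.coe_mk] at this
  rwa [Nat.sub_add_cancel h1] at this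

/-- Independent weights number at most `n - 1`. -/
theorem le_pred (H : IsNormal hn br b h m φ σ) : f ≤ n - 1 := by
  simpa using LinearMap.finrank_le_finrank_of_injective H.weightMap_injective

/-- If `f = n - 1`, then all weights occur. -/
theorem exists_weight (H : IsNormal hn br b h m φ σ) (hf : f = n - 1) (g : ℕ → F) :
    ∃ c : Fin f → F, ∀ i k, 1 ≤ i → i ≤ k → k ≤ n →
      ∑ α, c α * (h α i - h α k) = g i - g k := by
  obtain ⟨c, hc⟩ := (LinearMap.injective_iff_surjective_of_finrank_eq_finrank
    (by simp [hf])).1 H.weightMap_injective fun j => g (j + 1) - g (j + 1 + 1)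
  refine ⟨c, fun i k hi hik => ?_⟩
  induction k, hik using Nat.le_induction with
  | base => simp
  | succ k hik ih =>
    intro hk
    have h1 := congrFun hc ⟨k - 1, by omega⟩
    simp only [weightMap, LinearMap.coe_mk, AddHom.coe_mk] at h1
    rw [Nat.sub_add_cancel (by omega)] at h1
    rw [← sub_add_sub_cancel (g i) (g k), ← ih (by omega), ← h1, ← Finset.sum_add_distrib]
    exact Finset.sum_congr rfl fun α _ => by ring

theorem exists_corner_ne (H : IsNormal hn br b h m φ σ) (hf : f = n - 1) :
    ∃ γ, h γ 1 - h γ n ≠ 0 := by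
  by_contra! hall
  obtain ⟨c, hc⟩ := H.exists_weight hf fun i => if i = 1 then 1 else 0
  have := hc 1 n le_rfl (by omega) le_rfl
  simp only [hall, mul_zero, Finset.sum_const_zero, if_true] at this
  rw [if_neg (by omega)] at this
  simp at this

theorem exists_target_ne (H : IsNormal hn br b h m φ σ) (hf : f = n - 1) {p : Idx n}
    (hp : p.Simple) :
    ∃ β, h β p.1.1 - h β p.1.2 ≠ h β (p.target hn).1.1 - h β (p.target hn).1.2 := by
  by_contra! hall
  -- an element with weights `1, 0, …, 0` separates `p` from its target
  obtain ⟨c, hc⟩ := H.exists_weight hf fun i => if i = 1 then 1 else 0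
  have ht := mem_pairs.1 (p.target hn).2
  have h1 := hc _ _ p.one_le p.lt.le p.le
  have h2 := hc _ _ ht.1 ht.2.1.le ht.2.2
  simp only [hall] at h1
  rw [h1] at h2
  have h4 := p.one_le
  have h5 := p.le
  have h6 : p.1.2 = p.1.1 + 1 := hp
  simp only [Idx.target, exceptional] at h2
  rw [if_neg (show ¬ p.1.2 = 1 by omega)] at h2
  by_cases hi : p.1.1 = 1
  · simp only [if_pos hi] at h2
    rw [if_neg (by omega), if_neg (by omega)] at h2
    simp at h2
  · simp only [if_neg hi] at h2
    split_ifs at h2 <;> first | omega | simp at h2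

theorem isLie (H : IsNormal hn br b h m φ σ) {γ : Fin f} (hγ : h γ 1 - h γ n ≠ 0) : IsLie br := by
  refine ⟨H.leibniz, fun x y => ?_⟩
  have hNX : ∀ α p, br (b (.inr p)) (b (.inl α)) = -br (b (.inl α)) (b (.inr p)) := fun α p => by
    rw [H.N_X, H.φ_eq_zero hγ, zero_smul, add_zero]
  have : br = -br.flip := by
    refine b.ext fun i => b.ext fun j => ?_
    rw [LinearMap.neg_apply, LinearMap.neg_apply, LinearMap.flip_apply]
    rcases i with α | p <;> rcases j with β | q
    · rw [H.X_X, H.X_X, H.σ_antisymm hγ, neg_smul]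
    · rw [hNX, neg_neg]
    · rw [hNX]
    · exact H.antisymm (mem_nilSpan p) (mem_nilSpan q)
  exact LinearMap.congr_fun₂ this x y

/-- The matrices of a reduced normal form satisfy all conditions of the canonical form. -/
theorem isCanonical (H : IsNormal hn br b h m φ σ)
    (hred : ∀ p : Idx n,
      (∃ β, h β p.1.1 - h β p.1.2 ≠ h β (p.target hn).1.1 - h β (p.target hn).1.2) →
        ∀ α, m α p = 0)
    (hσ : (∃ γ, h γ 1 - h γ n ≠ 0) → ∀ α β, σ α β = 0) :
    IsCanonical hn br b (fun α => leftMatrix hn (h α) (m α))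
      (fun α => rightMatrix hn (h α) (m α) (φ α)) σ := by
  have hXN : ∀ α p, br (b (.inl α)) (b (.inr p)) =
      ∑ q, leftMatrix hn (h α) (m α) p q • b (.inr q) := fun α p => by
    rw [sum_leftMatrix_smul, H.X_N]
  have hNX : ∀ α p, br (b (.inr p)) (b (.inl α)) =
      ∑ q, rightMatrix hn (h α) (m α) (φ α) p q • b (.inr q) := fun α p => by
    rw [sum_rightMatrix_smul, H.N_X, H.X_N]
  have hli : LinearIndependent F fun p : Idx n => b (.inr p) :=
    b.linearIndependent.comp _ Sum.inr_injective
  have hcor : ∀ α, leftMatrix hn (h α) (m α) (Idx.corner hn) (Idx.corner hn) = h α 1 - h α n :=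
    fun α => leftMatrix_self (H.m_zero α) _
  have hoff : ∀ α p q, p ≠ q → (∃ β, leftMatrix hn (h β) (m β) p p ≠
      leftMatrix hn (h β) (m β) q q) → leftMatrix hn (h α) (m α) p q = 0 := by
    rintro α p q hpq ⟨β, hβ⟩
    rw [leftMatrix_self (H.m_zero β), leftMatrix_self (H.m_zero β)] at hβ
    by_cases hq : q = p.target hn
    · subst hq
      rw [leftMatrix, if_neg hpq.symm, hred p ⟨β, hβ⟩, ite_self, add_zero]
    · rw [leftMatrix, if_neg hpq.symm, if_neg hq, add_zero]
  refine
    { nilradical := H.nilradical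
      bracket_N_N := H.rel
      bracket_X_N := hXN
      bracket_N_X := hNX
      bracket_X_X := H.X_X
      nilindependent := H.nilindependent
      form_A := fun α => leftMatrix_hasForm (H.m_zero α)
      form_B := fun α => rightMatrix_hasForm (H.m_zero α) (H.φ_zero α)
      commute_A_A := fun α β => commute_of_smul_eq hli fun p => ?_
      commute_A_B := fun α β => commute_of_smul_eq hli fun p => ?_
      B_eq_neg_A := fun α p q hq => ?_
      B_corner := fun α => ?_
      lie_of_corner := ?_
      offDiag_zero := fun α p q hpq hβ => ⟨hoff α p q hpq hβ, ?_⟩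
      maximal := fun hf => ⟨?_, fun α p q hpq => ?_, hσ (H.exists_corner_ne hf)⟩ }
  · simp only [← hXN, ← map_smul, ← map_sum]
    exact H.X_X_N β α p
  · have h1 := H.X_N_X β α p
    simp only [hNX, hXN, map_sum, map_smul, LinearMap.sum_apply, LinearMap.smul_apply] at h1
    exact h1.symm
  · simp only [rightMatrix, if_neg hq, add_zero]
  · rw [rightMatrix_self (H.m_zero α) (H.φ_zero α), leftMatrix_self (H.m_zero α)]
  · rintro ⟨γ, hγ⟩
    rw [hcor] at hγ
    exact ⟨H.isLie hγ, hσ ⟨γ, hγ⟩⟩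
  · rw [rightMatrix, hoff α p q hpq hβ, neg_zero, zero_add]
    split_ifs with hq
    · subst hq
      obtain ⟨β, hβ⟩ := hβ
      rw [hcor, leftMatrix_self (H.m_zero β)] at hβ
      exact (mul_eq_zero.1 (H.φ_mul α β p)).resolve_right (sub_ne_zero.2 hβ)
    · rfl
  · obtain ⟨γ, hγ⟩ := H.exists_corner_ne hf
    exact H.isLie hγ
  · change leftMatrix hn (h α) (m α) p q = 0
    by_cases hp : p.Simple
    · rw [leftMatrix, if_neg (Ne.symm hpq), hred p (H.exists_target_ne hf hp), ite_self, add_zero]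
    · exact leftMatrix_eq_zero (H.m_zero α) hpq fun h => hp h.1

end IsNormal

/-- Every extension of `T(n)` has a reduced normal form. -/
theorem IsTriangularExtension.exists_isNormal [CharZero F] [FiniteDimensional F L] (hn : 4 ≤ n)
    (hL : IsTriangularExtension n br) :
    ∃ (f : ℕ) (b : Module.Basis (Fin f ⊕ Idx n) F L) (h : Fin f → ℕ → F)
      (m φ : Fin f → Idx n → F) (σ : Fin f → Fin f → F), IsNormal hn br b h m φ σ ∧ 1 ≤ f ∧
      (∀ p : Idx n,
        (∃ β, h β p.1.1 - h β p.1.2 ≠ h β (p.target hn).1.1 - h β (p.target hn).1.2) →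
          ∀ α, m α p = 0) ∧
      ((∃ γ, h γ 1 - h γ n ≠ 0) → ∀ α β, σ α β = 0) := by
  obtain ⟨N, hN, hrad, hrel⟩ := hL.nilradical
  obtain ⟨f, b, hb⟩ := exists_adapted_basis hN
  have hspan : nilSpan b = Submodule.span F (Set.range N) := by simp only [nilSpan, hb]
  rw [← hspan] at hrad
  have H : IsFrame br b := ⟨hL.leibniz, hrad.1.1, by simpa only [hb] using hrel⟩
  have hf : 1 ≤ f := by
    by_contra! hf
    obtain rfl : f = 0 := by omega
    refine hL.not_nilpotent ?_
    have htop : nilSpan b = ⊤ := by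
      rw [eq_top_iff, ← b.span_eq]
      refine Submodule.span_le.2 ?_
      rintro _ ⟨α | p, rfl⟩
      · exact α.elim0
      · exact mem_nilSpan p
    exact htop ▸ hrad.1.2
  obtain ⟨b₁, h, m₁, φ, σ₁, H₁⟩ := H.exists_isNormal hn hrad (H.weightKer_le hn hL.solvable hrad)
  obtain ⟨b₂, m, H₂, hred⟩ := H₁.exists_reduced
  by_cases hγ : ∃ γ, h γ 1 - h γ n ≠ 0
  · obtain ⟨γ, hγ⟩ := hγ
    obtain ⟨b₃, H₃⟩ := H₂.exists_commuting hγ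
    exact ⟨f, b₃, h, m, φ, _, H₃, hf, hred, fun _ _ _ => rfl⟩
  · exact ⟨f, b₂, h, m, φ, _, H₂, hf, hred, fun h' => absurd h' hγ⟩

theorem IsNormal.finrank_eq {hn : 4 ≤ n} {h : Fin f → ℕ → F} {m φ : Fin f → Idx n → F}
    {σ : Fin f → Fin f → F} (_ : IsNormal hn br b h m φ σ) :
    Module.finrank F L = n * (n - 1) / 2 + f := by
  rw [Module.finrank_eq_card_basis b, Fintype.card_sum, Fintype.card_fin, card_idx, add_comm]

/-! ### Recognizing the nilradical -/

namespace IsFrame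

variable [CharZero F] (H : IsFrame br b)
include H

/-- Elements of a nilpotent ideal have vanishing weights. -/
theorem le_weightKer (hn : 4 ≤ n) {I : Submodule F L} (hI : IsIdeal br I)
    (hnil : IsNilpotentSubalgebra br I) : I ≤ weightKer br b := by
  intro x hx
  refine mem_weightKer.2 fun j h1 h2 => ?_
  obtain ⟨K, hK⟩ := hnil
  let s : ℕ → L := fun k => (br x)^[k] (elt b j (j + 1))
  have hs : ∀ k, s (k + 1) = br x (s k) := fun k => Function.iterate_succ_apply' _ _ _
  have hmem : ∀ k, s k ∈ nilSpan b := by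
    intro k
    induction k with
    | zero => exact elt_mem _ _
    | succ k ih => exact hs k ▸ H.br_left_mem x ih
  have hcoeff : ∀ k, coeff b j (j + 1) (s k) = weight br b j x ^ k := by
    intro k
    induction k with
    | zero =>
      refine (coeff_elt (mk_mem_pairs.2 (by omega))).trans ?_
      rw [if_pos ⟨rfl, rfl⟩, pow_zero]
    | succ k ih => rw [hs, H.coeff_simple_br hn x (hmem k) h1 h2, ih, pow_succ']
  have hlow : ∀ k, s (k + 1) ∈ lowerCentralSeries br I k := by
    intro k
    induction k with
    | zero => exact (hI (elt b j (j + 1)) x hx).2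
    | succ k ih => exact hs (k + 1) ▸ Submodule.apply_mem_map₂ _ hx ih
  have h3 := hlow K
  rw [hK, Submodule.mem_bot] at h3
  have h4 := hcoeff (K + 1)
  rw [h3, map_zero] at h4
  exact IsReduced.eq_zero _ ⟨_, h4.symm⟩

theorem isNilradical (hn : 4 ≤ n) (hker : weightKer br b ≤ nilSpan b) :
    IsNilradical br (nilSpan b) := by
  refine ⟨⟨H.ideal, H.isNilpotent_of_le hn H.nilSpan_le_weightKer ?_⟩, fun I hI => ?_⟩
  · exact Submodule.map₂_le.2 fun u _ v hv => H.br_left_mem u hv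
  · exact (H.le_weightKer hn hI.1 hI.2).trans hker

theorem isSolvable (hn : 4 ≤ n) (hker : weightKer br b ≤ nilSpan b) : IsSolvable br := by
  have key : ∀ k, derivedSeries br (k + 1) ≤ level b (k + 1) := by
    intro k
    induction k with
    | zero =>
      refine Submodule.map₂_le.2 fun u _ v _ => nilSpan_le_level (hker ?_)
      exact mem_weightKer.2 fun j h1 h2 => H.weight_br hn _ _ h1 h2
    | succ k ih =>
      refine Submodule.map₂_le.2 fun u hu v hv => H.br_mem_level hn ?_ (ih hv)
      exact H.nilSpan_le_weightKer (level_le_nilSpan _ (ih hu))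
  exact ⟨n + 1, eq_bot_iff.2 ((key n).trans (level_eq_bot n.le_succ).le)⟩

theorem isTriangularExtension (hn : 4 ≤ n) (hf : 1 ≤ f) (hker : weightKer br b ≤ nilSpan b) :
    IsTriangularExtension n br where
  leibniz := H.leibniz
  solvable := H.isSolvable hn hker
  nilradical := ⟨fun p => b (.inr p), b.linearIndependent.comp _ Sum.inr_injective,
    H.isNilradical hn hker, H.rel⟩
  not_nilpotent := by
    intro htop
    have h1 : b (.inl ⟨0, hf⟩) ∈ nilSpan b := (H.isNilradical hn hker).2
      ⟨fun _ _ _ => ⟨Submodule.mem_top, Submodule.mem_top⟩, htop⟩ Submodule.mem_top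
    have h2 := repr_inl_of_mem h1 ⟨0, hf⟩
    rw [Module.Basis.repr_self, Finsupp.single_eq_same] at h2
    exact one_ne_zero h2

end IsFrame

end Frame

/-! ### The diagonal models -/

section Model

attribute [local instance] LieRing.ofAssociativeRing

variable {F : Type*} [Field F] {n f : ℕ}

/-- The index `i`, with `1 ≤ i ≤ n`, as a row of an `n × n` matrix. -/
def Idx.row (p : Idx n) : Fin n := ⟨p.1.1 - 1, by have := p.lt; have := p.le; omega⟩

/-- The index `k`, with `1 ≤ k ≤ n`, as a column of an `n × n` matrix. -/
def Idx.col (p : Idx n) : Fin n := ⟨p.1.2 - 1, by have := p.lt; have := p.le; omega⟩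

theorem Idx.col_eq_row {p q : Idx n} : p.col = q.row ↔ p.1.2 = q.1.1 := by
  have := p.lt
  have := q.one_le
  rw [Idx.col, Idx.row, Fin.mk.injEq]
  omega

theorem Idx.row_ne_col (p : Idx n) : p.row ≠ p.col := by
  have := p.lt
  have := p.one_le
  rw [Idx.col, Idx.row, ne_eq, Fin.mk.injEq]
  omega

theorem Idx.ext_row_col {p q : Idx n} (h1 : p.row = q.row) (h2 : p.col = q.col) : p = q := by
  have := p.one_le
  have := q.one_le
  have := p.lt
  have := q.lt
  rw [Idx.row, Idx.row, Fin.mk.injEq] at h1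
  rw [Idx.col, Idx.col, Fin.mk.injEq] at h2
  exact Idx.ext' (by omega) (by omega)

/-- Diagonal matrices `diag (g α 1, …, g α n)` and the matrix units above the diagonal. -/
def modelVector (g : Fin f → ℕ → F) : Fin f ⊕ Idx n → Matrix (Fin n) (Fin n) F :=
  Sum.elim (fun α => Matrix.diagonal fun i : Fin n => g α (i + 1))
    (fun p => Matrix.single p.row p.col 1)

variable (g : Fin f → ℕ → F)

theorem lie_inl_inl (α β : Fin f) :
    ⁅modelVector (n := n) g (.inl α), modelVector (n := n) g (.inl β)⁆ = 0 := by
  rw [Ring.lie_def, sub_eq_zero]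
  simp only [modelVector, Sum.elim_inl, Matrix.diagonal_mul_diagonal, mul_comm]

theorem lie_inl_inr (α : Fin f) (p : Idx n) :
    ⁅modelVector (n := n) g (.inl α), modelVector g (.inr p)⁆ =
      (g α p.1.1 - g α p.1.2) • modelVector g (.inr p) := by
  have h1 := p.one_le
  have h2 := p.lt
  have hr : (p.row : ℕ) + 1 = p.1.1 := Nat.sub_add_cancel h1
  have hc : (p.col : ℕ) + 1 = p.1.2 := Nat.sub_add_cancel (by omega)
  rw [Ring.lie_def]
  simp only [modelVector, Sum.elim_inl, Sum.elim_inr]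
  ext i j
  rw [Matrix.sub_apply, Matrix.diagonal_mul, Matrix.mul_diagonal, Matrix.smul_apply,
    Matrix.single_apply]
  split_ifs with h
  · obtain ⟨rfl, rfl⟩ := h
    rw [hr, hc, smul_eq_mul]
    ring
  · simp

theorem lie_inr_inr (p q : Idx n) :
    ⁅modelVector (n := n) g (.inr p), modelVector g (.inr q)⁆ =
      (if h : p.1.2 = q.1.1 then modelVector g (.inr (p.join q h)) else 0) -
        (if h : q.1.2 = p.1.1 then modelVector g (.inr (q.join p h)) else 0) := by
  have key : ∀ p q : Idx n, modelVector (n := n) g (.inr p) *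
      modelVector g (.inr q) =
      if h : p.1.2 = q.1.1 then modelVector g (.inr (p.join q h)) else 0 := by
    intro p q
    simp only [modelVector, Sum.elim_inr]
    split_ifs with h
    · rw [← Idx.col_eq_row] at h
      rw [h, Matrix.single_mul_single_same, mul_one]
      rfl
    · exact Matrix.single_mul_single_of_ne _ _ _ _ (mt Idx.col_eq_row.1 h) _
  rw [Ring.lie_def, key, key]

theorem linearIndependent_modelVector
    (hg : ∀ c : Fin f → F,
      (∀ j, 1 ≤ j → j + 1 ≤ n → ∑ α, c α * (g α j - g α (j + 1)) = 0) → c = 0) :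
    LinearIndependent F (modelVector (n := n) g) := by
  rw [Fintype.linearIndependent_iff]
  intro c hc
  rw [Fintype.sum_sum_type] at hc
  simp only [modelVector, Sum.elim_inl, Sum.elim_inr] at hc
  have hentry := fun i j => congrFun (congrFun hc i) j
  simp only [Matrix.add_apply, Matrix.sum_apply, Matrix.smul_apply, Matrix.zero_apply,
    smul_eq_mul] at hentry
  rintro (α | p)
  · have hd : ∀ i : Fin n, ∑ α, c (.inl α) * g α (i + 1) = 0 := by
      intro i
      have h1 := hentry i i
      rw [Finset.sum_eq_zero (s := (Finset.univ : Finset (Idx n))), add_zero] at h1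
      · simpa only [Matrix.diagonal_apply_eq] using h1
      · intro p _
        rw [Matrix.single_apply, if_neg, mul_zero]
        rintro ⟨h2, h3⟩
        exact p.row_ne_col (h2.trans h3.symm)
    refine congrFun (hg (fun α => c (.inl α)) fun j h1 h2 => ?_) α
    have h3 := hd ⟨j - 1, by omega⟩
    have h4 := hd ⟨j, by omega⟩
    simp only [Nat.sub_add_cancel h1] at h3
    simp only [mul_sub, Finset.sum_sub_distrib, h3, h4, sub_zero]
  · have h1 := hentry p.row p.col
    rw [Finset.sum_eq_zero (s := (Finset.univ : Finset (Fin f))), zero_add,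
      Finset.sum_eq_single p] at h1
    · simpa only [Matrix.single_apply_same, mul_one] using h1
    · intro q _ hq
      rw [Matrix.single_apply, if_neg, mul_zero]
      rintro ⟨h2, h3⟩
      exact hq (Idx.ext_row_col h2 h3)
    · simp
    · intro α _
      rw [Matrix.diagonal_apply_ne _ p.row_ne_col, mul_zero]

/-- The Lie algebra of matrices spanned by the vectors `modelVector g`. -/
def model (n : ℕ) (g : Fin f → ℕ → F) : LieSubalgebra F (Matrix (Fin n) (Fin n) F) where
  __ := Submodule.span F (Set.range (modelVector (n := n) g))
  lie_mem' := by
    intro x y hx hy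
    have hle : Submodule.map₂ (LieModule.toEnd F (Matrix (Fin n) (Fin n) F)
        (Matrix (Fin n) (Fin n) F)).toLinearMap
        (Submodule.span F (Set.range (modelVector (n := n) g)))
        (Submodule.span F (Set.range (modelVector (n := n) g))) ≤
        Submodule.span F (Set.range (modelVector (n := n) g)) := by
      rw [Submodule.map₂_span_span]
      refine Submodule.span_le.2 ?_
      have hm : ∀ i, modelVector (n := n) g i ∈
          Submodule.span F (Set.range (modelVector (n := n) g)) :=
        fun i => Submodule.subset_span ⟨i, rfl⟩
      rintro _ ⟨_, ⟨i, rfl⟩, _, ⟨j, rfl⟩, rfl⟩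
      change ⁅modelVector (n := n) g i, modelVector g j⁆ ∈ Submodule.span F _
      rcases i with α | p <;> rcases j with β | q
      · rw [lie_inl_inl]
        exact zero_mem _
      · rw [lie_inl_inr]
        exact Submodule.smul_mem _ _ (hm _)
      · rw [← lie_skew, lie_inl_inr]
        exact neg_mem (Submodule.smul_mem _ _ (hm _))
      · rw [lie_inr_inr]
        refine sub_mem ?_ ?_
        · split_ifs
          · exact hm _
          · exact zero_mem _
        · split_ifs
          · exact hm _
          · exact zero_mem _
    exact hle (Submodule.apply_mem_map₂ _ hx hy)

/-- The Lie bracket of the model as a bilinear map. -/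
def modelBr (n : ℕ) (g : Fin f → ℕ → F) : model n g →ₗ[F] model n g →ₗ[F] model n g :=
  (LieModule.toEnd F (model n g) (model n g)).toLinearMap

theorem modelBr_apply (x y : model n g) : modelBr n g x y = ⁅x, y⁆ := rfl

theorem modelBr_isLie : IsLie (modelBr n g) :=
  ⟨fun x y z => leibniz_lie x y z, fun x y => (lie_skew x y).symm⟩

/-- The diagonal matrices act on the matrix units in normal form, without off-diagonal terms. -/
theorem exists_model_isNormal [CharZero F] (hn : 4 ≤ n) (hf : 1 ≤ f)
    (hg : ∀ c : Fin f → F,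
      (∀ j, 1 ≤ j → j + 1 ≤ n → ∑ α, c α * (g α j - g α (j + 1)) = 0) → c = 0) :
    IsTriangularExtension n (modelBr n g) ∧
      ∃ b : Module.Basis (Fin f ⊕ Idx n) F (model n g),
        IsNormal hn (modelBr n g) b g (fun _ _ => 0) (fun _ _ => 0) fun _ _ => 0 := by
  let b : Module.Basis (Fin f ⊕ Idx n) F (model n g) :=
    Module.Basis.span (linearIndependent_modelVector g hg)
  have hb : ∀ i, (b i : Matrix (Fin n) (Fin n) F) = modelVector g i :=
    fun i => congrArg Subtype.val (Module.Basis.span_apply (linearIndependent_modelVector g hg) i)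
  have hXX : ∀ α β, modelBr n g (b (.inl α)) (b (.inl β)) = 0 := by
    intro α β
    apply Subtype.ext
    rw [modelBr_apply, LieSubalgebra.coe_bracket, hb, hb, lie_inl_inl]
    rfl
  have hXN : ∀ α p, modelBr n g (b (.inl α)) (b (.inr p)) =
      (g α p.1.1 - g α p.1.2) • b (.inr p) := by
    intro α p
    apply Subtype.ext
    change ⁅(b (.inl α) : Matrix (Fin n) (Fin n) F), (b (.inr p) : Matrix (Fin n) (Fin n) F)⁆ =
      (g α p.1.1 - g α p.1.2) • (b (.inr p) : Matrix (Fin n) (Fin n) F)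
    rw [hb, hb, lie_inl_inr]
  have hNN : TriangularRelations (modelBr n g) fun p : Idx n => b (.inr p) := by
    intro p q
    apply Subtype.ext
    rw [modelBr_apply, LieSubalgebra.coe_bracket, hb, hb, lie_inr_inr, AddSubgroupClass.coe_sub]
    congr 1 <;> split_ifs <;> simp only [hb, ZeroMemClass.coe_zero]
  have hideal : ∀ x, ∀ y ∈ nilSpan b, modelBr n g x y ∈ nilSpan b := by
    intro x y hy
    have hle : ⊤ ≤ (nilSpan b).comap ((modelBr n g).flip y) := by
      rw [← b.span_eq]
      refine Submodule.span_le.2 ?_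
      rintro _ ⟨i, rfl⟩
      have hle' : nilSpan b ≤ (nilSpan b).comap (modelBr n g (b i)) := by
        refine Submodule.span_le.2 ?_
        rintro _ ⟨p, rfl⟩
        change modelBr n g (b i) (b (.inr p)) ∈ nilSpan b
        rcases i with α | q
        · rw [hXN]
          exact Submodule.smul_mem _ _ (mem_nilSpan p)
        · rw [show modelBr n g (b (.inr q)) (b (.inr p)) = _ from hNN q p]
          refine sub_mem ?_ ?_
          · split_ifs
            · exact mem_nilSpan _
            · exact zero_mem _
          · split_ifs
            · exact mem_nilSpan _
            · exact zero_mem _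
      exact hle' hy
    exact hle Submodule.mem_top
  have hskew := (modelBr_isLie (n := n) g).2
  have H : IsFrame (modelBr n g) b := ⟨(modelBr_isLie g).1, fun x y hy =>
    ⟨hideal x y hy, hskew y x ▸ neg_mem (hideal x y hy)⟩, hNN⟩
  have hker : weightKer (modelBr n g) b ≤ nilSpan b := by
    intro x hx
    rw [mem_weightKer] at hx
    have hsum := b.sum_repr x
    rw [Fintype.sum_sum_type] at hsum
    have hr : ∑ p, b.repr x (.inr p) • b (.inr p) ∈ nilSpan b :=
      sum_mem fun p _ => Submodule.smul_mem _ _ (mem_nilSpan p)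
    have hc := hg (fun α => b.repr x (.inl α)) fun j h1 h2 => by
      have h3 := hx j h1 h2
      rw [← hsum, map_add, H.weight_of_mem hr h1 h2, add_zero, map_sum] at h3
      rw [← h3]
      refine Finset.sum_congr rfl fun α _ => ?_
      have hj : (j, j + 1) ∈ pairs n := mk_mem_pairs.2 (by omega)
      rw [map_smul, smul_eq_mul, weight_apply, elt_of_mem hj, hXN, map_smul, ← elt_of_mem hj,
        coeff_elt hj, if_pos ⟨rfl, rfl⟩, smul_eq_mul, mul_one]
    rw [← hsum, Finset.sum_eq_zero, zero_add]
    · exact hr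
    · intro α _
      rw [show b.repr x (.inl α) = 0 from congrFun hc α, zero_smul]
  refine ⟨H.isTriangularExtension hn hf hker, b, ?_⟩
  exact
    { toIsFrame := H
      nilradical := H.isNilradical hn hker
      X_N := fun α p => by rw [hXN, zero_smul, add_zero]
      N_X := fun α p => by rw [zero_smul, add_zero]; exact hskew _ _
      X_X := fun α β => by rw [hXX, zero_smul]
      m_zero := fun _ _ _ => rfl
      φ_zero := fun _ _ _ => rfl
      indep := hg }

/-- The potentials with given differences `d`. -/
def potentialOf (d : Fin (n - 1) → F) (i : ℕ) : F :=
  ∑ j : Fin (n - 1), if i ≤ j + 1 then d j else 0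

theorem potentialOf_sub (d : Fin (n - 1) → F) (j : Fin (n - 1)) :
    potentialOf d (j + 1) - potentialOf d (j + 1 + 1) = d j := by
  rw [potentialOf, potentialOf, ← Finset.sum_sub_distrib, Finset.sum_eq_single j]
  · rw [if_pos le_rfl, if_neg (by omega), sub_zero]
  · intro i _ hij
    have : (i : ℕ) ≠ j := fun h => hij (Fin.ext h)
    split_ifs <;> first | omega | simp
  · simp

theorem potentialOf_indep {d : Fin f → Fin (n - 1) → F} (hd : LinearIndependent F d)
    (c : Fin f → F) (hc : ∀ j, 1 ≤ j → j + 1 ≤ n →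
      ∑ α, c α * (potentialOf (d α) j - potentialOf (d α) (j + 1)) = 0) : c = 0 := by
  funext α
  refine Fintype.linearIndependent_iff.1 hd c ?_ α
  funext j
  have h := hc (j + 1) (by omega) (by omega)
  simp only [potentialOf_sub] at h
  simpa using h

theorem potentialOf_differences (h : ℕ → F) {i k : ℕ} (hi : 1 ≤ i) (hik : i ≤ k) (hk : k ≤ n) :
    potentialOf (n := n) (fun j => h (j + 1) - h (j + 1 + 1)) i -
      potentialOf (n := n) (fun j => h (j + 1) - h (j + 1 + 1)) k = h i - h k := by
  induction k, hik using Nat.le_induction with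
  | base => simp
  | succ k hik ih =>
    have h1 := potentialOf_sub (n := n) (fun j => h (j + 1) - h (j + 1 + 1)) ⟨k - 1, by omega⟩
    simp only [Nat.sub_add_cancel (hi.trans hik)] at h1
    linear_combination ih (by omega) + h1

theorem sum_mul_potentialOf_single (d : Fin (n - 1) → F) (i : ℕ) :
    ∑ j, d j * potentialOf (n := n) (Pi.single j 1) i = potentialOf d i := by
  refine Finset.sum_congr rfl fun j _ => ?_
  rw [potentialOf, Finset.sum_eq_single j]
  · rw [Pi.single_eq_same, mul_ite, mul_one, mul_zero]
  · intro k _ hk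
    rw [Pi.single_eq_of_ne hk, ite_self]
  · simp

end Model

/-! ### Uniqueness in the maximal case -/

section Uniqueness

variable {F : Type*} [Field F] {L : Type*} [AddCommGroup L] [Module F L]
  {M : Type*} [AddCommGroup M] [Module F M] {n : ℕ} {hn : 4 ≤ n}
  {br : L →ₗ[F] L →ₗ[F] L} {brM : M →ₗ[F] M →ₗ[F] M}

/-- For `f = n - 1`, suppose that the `X^α` commute and act diagonally. If in `M` the `j`-th
diagonal element has weight `1` at `N_{j(j+1)}` and weight `0` at the other generators, the
isomorphism sends `X^α` to the combination of these elements that acts on `T(n)` like `X^α`. -/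
theorem IsNormal.isIsomorphic {f : ℕ} (hf : f = n - 1)
    {b : Module.Basis (Fin f ⊕ Idx n) F L} {h : Fin f → ℕ → F}
    (H : IsNormal hn br b h (fun _ _ => 0) (fun _ _ => 0) fun _ _ => 0)
    {bM : Module.Basis (Fin (n - 1) ⊕ Idx n) F M}
    (HM : IsNormal hn brM bM (fun j => potentialOf (Pi.single j 1)) (fun _ _ => 0)
      (fun _ _ => 0) fun _ _ => 0) : IsIsomorphic br brM := by
  let d : Fin f → Fin (n - 1) → F := fun α j => h α (j + 1) - h α (j + 1 + 1)
  let e : L →ₗ[F] M := b.constr F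
    (Sum.elim (fun α => ∑ j, d α j • bM (.inl j)) fun p => bM (.inr p))
  have hel : ∀ α, e (b (.inl α)) = ∑ j, d α j • bM (.inl j) := fun α => b.constr_basis F _ _
  have her : ∀ p, e (b (.inr p)) = bM (.inr p) := fun p => b.constr_basis F _ _
  have hXN : ∀ α p, e (br (b (.inl α)) (b (.inr p))) =
      brM (e (b (.inl α))) (e (b (.inr p))) := by
    intro α p
    rw [H.X_N, hel, her, map_add, map_smul, map_smul, her, zero_smul, add_zero, map_sum,
      LinearMap.sum_apply]
    simp only [map_smul, LinearMap.smul_apply, HM.X_N, zero_smul, add_zero, smul_smul]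
    rw [← Finset.sum_smul]
    simp only [mul_sub, Finset.sum_sub_distrib, sum_mul_potentialOf_single]
    rw [potentialOf_differences (h α) p.one_le p.lt.le p.le]
  have hlie : ∀ α p, br (b (.inr p)) (b (.inl α)) = -br (b (.inl α)) (b (.inr p)) := by
    intro α p
    rw [H.N_X, zero_smul, add_zero]
  have hlieM : ∀ j p, brM (bM (.inr p)) (bM (.inl j)) = -brM (bM (.inl j)) (bM (.inr p)) := by
    intro j p
    rw [HM.N_X, zero_smul, add_zero]
  have hhom : ∀ x y, e (br x y) = brM (e x) (e y) := by
    have hcomp : br.compr₂ e = brM.compl₁₂ e e := by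
      refine b.ext fun i => b.ext fun j => ?_
      change e (br (b i) (b j)) = brM (e (b i)) (e (b j))
      rcases i with α | p <;> rcases j with β | q
      · rw [H.X_X, zero_smul, map_zero, hel, hel]
        simp only [map_sum, map_smul, LinearMap.sum_apply, LinearMap.smul_apply, HM.X_X,
          zero_smul, smul_zero, Finset.sum_const_zero]
      · exact hXN α q
      · rw [hlie, map_neg, hXN, hel, her]
        simp only [map_sum, map_smul, LinearMap.sum_apply, LinearMap.smul_apply, hlieM, smul_neg,
          Finset.sum_neg_distrib]
      · rw [show br (b (.inr p)) (b (.inr q)) = _ from H.rel p q, her, her,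
          show brM (bM (.inr p)) (bM (.inr q)) = _ from HM.rel p q, map_sub]
        congr 1 <;> split_ifs <;> simp only [her, map_zero]
    exact fun x y => LinearMap.congr_fun₂ hcomp x y
  have hinj : Function.Injective e := by
    rw [← LinearMap.ker_eq_bot, LinearMap.ker_eq_bot']
    intro x hx
    have hr : ∀ p, bM.repr (e x) (.inr p) = b.repr x (.inr p) := by
      intro p
      have : (bM.coord (.inr p)).comp e = b.coord (.inr p) := by
        refine b.ext fun i => ?_
        rcases i with α | q
        · simp [hel]
        · simp [her, Finsupp.single_apply]
      exact LinearMap.congr_fun this x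
    have hl : ∀ j, bM.repr (e x) (.inl j) = ∑ α, b.repr x (.inl α) * d α j := by
      intro j
      have : (bM.coord (.inl j)).comp e = ∑ α, d α j • b.coord (.inl α) := by
        refine b.ext fun i => ?_
        rcases i with α | q
        · simp [hel, Finsupp.single_apply]
        · simp [her]
      have h1 := LinearMap.congr_fun this x
      simpa [mul_comm] using h1
    rw [hx] at hr hl
    refine b.repr.map_eq_zero_iff.1 (Finsupp.ext fun i => ?_)
    rcases i with α | p
    · refine congrFun (H.indep (fun α => b.repr x (.inl α)) fun j h1 h2 => ?_) α
      have h3 := hl ⟨j - 1, by omega⟩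
      simp only [d, Nat.sub_add_cancel h1, map_zero, Finsupp.zero_apply] at h3
      exact h3.symm
    · rw [← hr]
      simp
  have : FiniteDimensional F L := Module.Basis.finiteDimensional_of_finite b
  have : FiniteDimensional F M := Module.Basis.finiteDimensional_of_finite bM
  refine ⟨LinearEquiv.ofInjectiveOfFinrankEq e hinj ?_, hhom⟩
  rw [H.finrank_eq, HM.finrank_eq, hf]

end Uniqueness

end Leibniz

open Leibniz in
theorem mainTheorem2 {F : Type u} [RCLike F] {n : ℕ} (hn : 4 ≤ n) :
    -- every non-nilpotent solvable Leibniz algebra with nilradical `T(n)` has a canonical form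
    (∀ (L : Type v) [AddCommGroup L] [Module F L] [FiniteDimensional F L]
        (br : L →ₗ[F] L →ₗ[F] L), IsTriangularExtension n br →
      ∃ f : ℕ, 1 ≤ f ∧ f ≤ n - 1 ∧ Module.finrank F L = n * (n - 1) / 2 + f ∧
        ∃ (b : Module.Basis (Fin f ⊕ Idx n) F L) (A B : Fin f → Matrix (Idx n) (Idx n) F)
          (σ : Fin f → Fin f → F), IsCanonical hn br b A B σ) ∧
    -- the diagonal entries `A^α_{j(j+1),j(j+1)}` are free (up to nilindependence)
    (∀ f : ℕ, 1 ≤ f → ∀ d : Fin f → Fin (n - 1) → F, LinearIndependent F d →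
      ∃ (M : Type u) (_ : AddCommGroup M) (_ : Module F M) (br : M →ₗ[F] M →ₗ[F] M),
        IsTriangularExtension n br ∧
        ∃ (b : Module.Basis (Fin f ⊕ Idx n) F M) (A B : Fin f → Matrix (Idx n) (Idx n) F)
          (σ : Fin f → Fin f → F), IsCanonical hn br b A B σ ∧
          ∀ (α : Fin f) (j : Fin (n - 1)) (p : Idx n),
            p.1 = (j.1 + 1, j.1 + 2) → A α p p = d α j) ∧
    -- for `f = n - 1` there is exactly one algebra up to isomorphism; it is the Lie algebra with
    -- diagonal `A^α` and commuting `X^α`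
    (∃ (M : Type u) (_ : AddCommGroup M) (_ : Module F M) (brM : M →ₗ[F] M →ₗ[F] M),
      IsTriangularExtension n brM ∧ IsLie brM ∧
      (∃ (b : Module.Basis (Fin (n - 1) ⊕ Idx n) F M)
          (A B : Fin (n - 1) → Matrix (Idx n) (Idx n) F) (σ : Fin (n - 1) → Fin (n - 1) → F),
        IsCanonical hn brM b A B σ ∧ (∀ α, (A α).IsDiag) ∧
          ∀ α β, brM (b (.inl α)) (b (.inl β)) = 0) ∧
      ∀ (L : Type v) [AddCommGroup L] [Module F L] [FiniteDimensional F L]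
        (br : L →ₗ[F] L →ₗ[F] L), IsTriangularExtension n br →
        Module.finrank F L = n * (n - 1) / 2 + (n - 1) → IsIsomorphic br brM) := by
  refine ⟨?_, ?_, ?_⟩
  · intro L _ _ _ br hL
    obtain ⟨f, b, h, m, φ, σ, H, hf, hred, hσ⟩ := hL.exists_isNormal hn
    exact ⟨f, hf, H.le_pred, H.finrank_eq, b, _, _, σ, H.isCanonical hred hσ⟩
  · intro f hf d hd
    obtain ⟨hext, b, H⟩ := exists_model_isNormal (fun α => potentialOf (d α)) hn hf
      (potentialOf_indep hd)
    refine ⟨model n fun α => potentialOf (d α), inferInstance, inferInstance, modelBr n _, hext, b,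
      _, _, _, H.isCanonical (fun _ _ _ => rfl) fun _ _ _ => rfl, fun α j p hp => ?_⟩
    rw [leftMatrix_self fun _ _ => rfl, hp]
    exact potentialOf_sub (d α) j
  · obtain ⟨hext, b, H⟩ := exists_model_isNormal
      (fun j : Fin (n - 1) => potentialOf (F := F) (Pi.single j 1)) hn (by omega)
      (potentialOf_indep (Pi.linearIndependent_single_one _ F))
    have hcan := H.isCanonical (fun _ _ _ => rfl) fun _ _ _ => rfl
    refine ⟨model n _, inferInstance, inferInstance, modelBr n _, hext, modelBr_isLie _,
      ⟨b, _, _, _, hcan, (hcan.maximal rfl).2.1, fun α β => by rw [H.X_X, zero_smul]⟩, ?_⟩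
    intro L _ _ _ br hL hdim
    obtain ⟨f, b', h, m, φ, σ, H', -, hred, hσ⟩ := hL.exists_isNormal hn
    have hf : f = n - 1 := by
      have := H'.finrank_eq
      omega
    obtain ⟨γ, hγ⟩ := H'.exists_corner_ne hf
    have hm : m = fun _ _ => 0 := by
      funext α p
      by_cases hp : p.Simple
      · exact hred p (H'.exists_target_ne hf hp) α
      · exact H'.m_zero α p hp
    have hφ : φ = fun _ _ => 0 := by
      funext α p
      exact H'.φ_eq_zero hγ α p
    have hσ0 : σ = fun _ _ => 0 := by
      funext α β
      exact hσ ⟨γ, hγ⟩ α β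
    subst hm hφ hσ0
    exact H'.isIsomorphic hf H
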